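/- Let $\mathbb K\in\{\mathbb R,\mathbb C\}$ and let $\Lambda=(\lambda_k)_{k\ge 0}$ be a strictly increasing sequence of non-negative real numbers satisfying the Müntz condition $\sum_{\lambda_k\neq 0}1/\lambda_k<\infty$. Let $C=C([0,1])$ be the space of continuous $\mathbb K$-valued functions on $[0,1]$ with the supremum norm $\|\cdot\|_\infty$, let $M_\Lambda$ be the linear span of the monomials $x^{\lambda_k}$, $k\ge 0$, and let $M_\Lambda^1$ and $M_\Lambda^\infty$ be the closures of $M_\Lambda$ in $L^1([0,1])$ and in $C$, respectively. Fix $q\in C$ and let $Q_\Lambda=q\cdot M_\Lambda^\infty=\{qg: g\in M_\Lambda^\infty\}$, a subspace of $C$ with the supremum norm. Proposition 4.4. Every $f\in M_\Lambda^1$ agrees almost everywhere with a function that is continuous on $[0,1)$, whose (uniquely determined) value at $0$ is denoted by $f(0)$. The formula $$H_q(f)(x)=\begin{cases} q(0)f(0) & \text{if } x=0,\\[2pt] \dfrac{q(x)}{x}\displaystyle\int_0^x f(t)\,dt & \text{if } x\in(0,1],\end{cases}$$ defines a bounded linear operator $H_q$ from $M_\Lambda^1$ to $Q_\Lambda\subset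 C$. With $\mathcal K(X,Y)$ denoting the set of compact linear operators from $X$ to $Y$, and $d$ the distance in the operator norm, we have $$d\bigl(H_q,\mathcal K(M_\Lambda^1,Q_\Lambda)\bigr)\le\frac{\|q\|_\infty}{2}\qquad\text{and}\qquad d\bigl(H_q,\mathcal K(M_\Lambda^1,C)\bigr)\le\frac{|q(1)|}{2}.$$ In the second inequality, $H_q$ is viewed as an operator from $M_\Lambda^1$ to $C$. -/

import Mathlib

open MeasureTheory
open scoped NNReal unitInterval

noncomputable section

namespace Muntz

variable (𝕜 : Type*) [RCLike 𝕜]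

/-- The monomial `x ↦ x ^ l` on `[0,1]`, for a real exponent `l ≥ 0`, as an element of `C([0,1])`
(with `x ^ 0 = 1` for all `x`). -/
def monomial (l : ℝ≥0) : C(I, 𝕜) where
  toFun x := (((x : ℝ) ^ (l : ℝ) : ℝ) : 𝕜)
  continuous_toFun := RCLike.continuous_ofReal.comp
    ((Real.continuous_rpow_const l.coe_nonneg).comp continuous_subtype_val)

/-- `M_Λ`: the linear span of the monomials with exponents in `Λ`. -/
def polySpace (Λ : ℕ → ℝ≥0) : Submodule 𝕜 C(I, 𝕜) :=
  Submodule.span 𝕜 (Set.range fun k => monomial 𝕜 (Λ k))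

/-- `M_Λ^∞`: the closure of `M_Λ` in `C([0,1])` with the supremum norm. -/
def spaceInf (Λ : ℕ → ℝ≥0) : Submodule 𝕜 C(I, 𝕜) :=
  (polySpace 𝕜 Λ).topologicalClosure

/-- `M_Λ^1`: the closure of (the classes of elements of) `M_Λ` in `L^1([0,1])`,
for Lebesgue measure on `[0,1]`. -/
def spaceOne (Λ : ℕ → ℝ≥0) : Submodule 𝕜 (Lp 𝕜 1 (volume : Measure I)) :=
  ((polySpace 𝕜 Λ).map
    (ContinuousMap.toLp 1 (volume : Measure I) 𝕜 :
      C(I, 𝕜) →L[𝕜] Lp 𝕜 1 (volume : Measure I)).toLinearMap).topologicalClosure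

variable {𝕜}

/-- `Q_Λ = q · M_Λ^∞ = {q g : g ∈ M_Λ^∞}`, a subspace of `C([0,1])` that carries the
supremum norm (it need not be closed). -/
def weightedSpace (Λ : ℕ → ℝ≥0) (q : C(I, 𝕜)) : Submodule 𝕜 C(I, 𝕜) :=
  (spaceInf 𝕜 Λ).map (LinearMap.mulLeft 𝕜 q)

/-- The supremum norm on `Q_Λ`. -/
instance (Λ : ℕ → ℝ≥0) (q : C(I, 𝕜)) : NormedAddCommGroup (weightedSpace Λ q) :=
  Submodule.normedAddCommGroup _

instance (Λ : ℕ → ℝ≥0) (q : C(I, 𝕜)) : NormedSpace 𝕜 (weightedSpace Λ q) :=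
  Submodule.normedSpace _

/-- `h = H_q(f)`, that is `h(0) = q(0) f(0)` and `h(x) = (q(x)/x) ∫_0^x f` for `0 < x ≤ 1`.
The class `f` has at most one representative `g` on `[0,1)` that is continuous there,
and `f(0)` stands for `g(0)`; the existence of `g` is part of the assertion. -/
def IsWeightedCesaro (q : C(I, 𝕜)) (f : Lp 𝕜 1 (volume : Measure I)) (h : I → 𝕜) : Prop :=
  ∃ g : I → 𝕜, ContinuousOn g {x | x < 1} ∧ f =ᵐ[volume] g ∧
    h 0 = q 0 * g 0 ∧
    ∀ x : I, 0 < x → h x = q x / ((x : ℝ) : 𝕜) * ∫ t in Set.Icc 0 x, f t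

/-- The distance, in operator norm, from `T` to the set `𝒦(X, Y)` of compact operators. -/
def distCompact {X Y : Type*} [SeminormedAddCommGroup X] [NormedSpace 𝕜 X]
    [SeminormedAddCommGroup Y] [NormedSpace 𝕜 Y] (T : X →L[𝕜] Y) : ℝ :=
  Metric.infDist T {S : X →L[𝕜] Y | IsCompactOperator S}

end Muntz

end

/-! Everything rests on one fact: for ρ < 1, Müntz polynomials with L¹ norm at most 1 are uniformly
bounded and equicontinuous on [0, ρ] (`exists_modulus_polySpace`). Hence p ↦ p(r·), r < 1, extends
to a compact operator from M_Λ^1 to C (`exists_dilation`), elements of M_Λ^1 are continuous on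
[0,1), and Ap(x) = ∫_0^1 p(tx) dt extends to a bounded operator into M_Λ^∞ (`exists_average`). H_q
is multiplication by q after A.

Distance to the compacts: subtracting from A the compact operator p ↦ r A(p(r·)) leaves (1/x)
∫_{rx}^x p. With ρ close to 1, and then r close to 1 depending on ρ, this is negligible for x ≤ ρ.
For x ≥ ρ, 1/x is nearly 1 and, up to a small error, the integral runs over a part of [ρ,1];
subtracting half of ∫_ρ^1 p leaves half the difference between the integrals over that part and over
its complement, at most ‖p‖₁/2. The correction is a rank-one operator with profile x^l, and after
multiplication by q the remainder has norm at most ‖q x^l‖/2 plus a small error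
(`exists_compact_approx`). Taking l = λ_0 keeps the range in Q_Λ; when the target is C, a large l
brings ‖q x^l‖ down to |q(1)|.

Equicontinuity: the L² norm of the antiderivative of p is at most ‖p‖₁ (`expEnergy_le_sq`). Under x
= e^{-t} it becomes the L² norm of an exponential sum with rates λ_k + 3/2, and reflecting one rate
at a time bounds ∑ c_k/(ζ - ν_k) by a Blaschke quotient (`normSq_resolvent_le`), which by the Müntz
condition grows subexponentially along a ray of slope one (`exists_prod_blaschke_le`). Integrating
these sums against x^ζ along the ray from α recovers the terms of p with exponent above α
(`integral_rayIntegrand_im`). Since x^ζ decays exponentially for x ≤ ρ < 1, the modulus of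
continuity is uniform in p (`exists_modulus`). Choosing α between λ_0 and λ_1 leaves a single term,
treated directly. -/

namespace Muntz

/-! ### Reflection of exponential sums and the resolvent bound -/

/-- The squared norm of `∑ c_k exp (-ν_k t)` in `L²(0,∞)`. -/
noncomputable def expEnergy (ν c : ℕ → ℝ) (s : Finset ℕ) : ℝ :=
  ∑ j ∈ s, ∑ k ∈ s, c j * c k / (ν j + ν k)

/-- This removes the orthogonal projection onto exp(-m t), whose squared norm is 1/(2m), and then
divides the Laplace transform by a Blaschke factor, an isometry. Algebraically, (ν_j + m)(ν_k + m) -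
(ν_j - m)(ν_k - m) = 2m(ν_j + ν_k). -/
lemma expEnergy_reflect (ν c : ℕ → ℝ) (hν : ∀ k, 0 < ν k) (s : Finset ℕ) (m : ℝ) (hm : 0 < m) :
    expEnergy ν (fun k => c k * ((ν k - m) / (ν k + m))) s
      = expEnergy ν c s - 2 * m * (∑ k ∈ s, c k / (ν k + m)) ^ 2 := by
  unfold expEnergy
  rw [sq, Finset.sum_mul_sum, Finset.mul_sum, ← Finset.sum_sub_distrib]
  refine Finset.sum_congr rfl fun j _ => ?_
  rw [Finset.mul_sum, ← Finset.sum_sub_distrib]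
  refine Finset.sum_congr rfl fun k _ => ?_
  have h1 := hν j
  have h2 := hν k
  field_simp
  ring

/-- Companion of `expEnergy_reflect` for the functional: the squared modulus of (ζ + m)/(ζ - m) is
the new Blaschke factor, and the remainder depends only on the removed projection. -/
lemma resolvent_reflect (ν c : ℕ → ℝ) (hν : ∀ k, 0 < ν k) (s : Finset ℕ) (m : ℝ) (hm : 0 < m)
    (ζ : ℂ) (hζ : 0 < ζ.re) (hne : ∀ k, ζ - ν k ≠ 0) (hnm : ζ - m ≠ 0) :
    ∑ k ∈ s, (c k : ℂ) / (ζ - ν k)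
      = (ζ + m) / (ζ - m) *
          ∑ k ∈ s, ((c k * ((ν k - m) / (ν k + m)) : ℝ) : ℂ) / (ζ - ν k)
        + 2 * m / (ζ - m) * ((∑ k ∈ s, c k / (ν k + m) : ℝ) : ℂ) := by
  push_cast
  rw [Finset.mul_sum, Finset.mul_sum, ← Finset.sum_add_distrib]
  refine Finset.sum_congr rfl fun k _ => ?_
  have h1 : (ν k + m : ℂ) ≠ 0 := by
    have : (ν k + m : ℝ) ≠ 0 := (add_pos (hν k) hm).ne'
    exact_mod_cast this
  have h2 := hne k
  have h3 : ζ + m ≠ 0 := by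
    intro h
    have := congrArg Complex.re h
    simp at this
    linarith
  field_simp
  ring

lemma normSq_add_eq (ζ : ℂ) (m : ℝ) :
    Complex.normSq (ζ + m) = Complex.normSq (ζ - m) + 4 * m * ζ.re := by
  simp only [Complex.normSq_apply, Complex.add_re, Complex.sub_re, Complex.add_im, Complex.sub_im,
    Complex.ofReal_re, Complex.ofReal_im]
  ring

/-- Cauchy–Schwarz in the plane for (√K, √D) and (√E, √B), written without square roots. -/
lemma sq_add_le_of_energy {a b K E D B : ℝ} (hD : 0 ≤ D) (hK : 0 ≤ K) (hE : 0 ≤ E)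
    (ha : a ^ 2 ≤ K * E) (hb : b ^ 2 ≤ D * B) (hB : 0 ≤ B) :
    (a + b) ^ 2 ≤ (K + D) * (E + B) := by
  have h : (2 * (a * b)) ≤ K * B + D * E := by
    have h1 : (a * b) ^ 2 ≤ (K * B) * (D * E) := by
      calc (a * b) ^ 2 = a ^ 2 * b ^ 2 := by ring
        _ ≤ (K * E) * (D * B) := mul_le_mul ha hb (sq_nonneg _) (by positivity)
        _ = _ := by ring
    have h2 : 0 ≤ K * B + D * E := by positivity
    apply le_of_sq_le_sq _ h2
    nlinarith [sq_nonneg (K * B - D * E)]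
  nlinarith

/-- The `L²` bound for the functional `∑ c_k exp (-ν_k t) ↦ ∑ c_k / (ζ - ν_k)`. -/
theorem normSq_resolvent_le (ν : ℕ → ℝ) (hν : ∀ k, 0 < ν k) (ζ : ℂ) (hζ : 0 < ζ.re)
    (hne : ∀ k, ζ - ν k ≠ 0) (s : Finset ℕ) : ∀ c : ℕ → ℝ, 0 ≤ expEnergy ν c s ∧
    Complex.normSq (∑ k ∈ s, (c k : ℂ) / (ζ - ν k)) ≤
      ((∏ k ∈ s, Complex.normSq (ζ + ν k) / Complex.normSq (ζ - ν k)) - 1) / (2 * ζ.re)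
        * expEnergy ν c s := by
  induction s using Finset.induction_on with
  | empty => intro c; simp [expEnergy]
  | insert n s hn ih =>
    intro c
    have hm := hν n
    set m := ν n with hmdef
    obtain ⟨hE, hS⟩ := ih (fun k => c k * ((ν k - m) / (ν k + m)))
    -- Reflection at m = ν_n annihilates the n-th coefficient, so the induction hypothesis on `s`
    -- applies.
    have hEn : expEnergy ν (fun k => c k * ((ν k - m) / (ν k + m))) (insert n s)
        = expEnergy ν (fun k => c k * ((ν k - m) / (ν k + m))) s := by
      simp [expEnergy, Finset.sum_insert hn, ← hmdef]
    have hrefl := expEnergy_reflect ν c hν (insert n s) m hm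
    rw [hEn] at hrefl
    set û := ∑ k ∈ insert n s, c k / (ν k + m)
    set Ev := expEnergy ν (fun k => c k * ((ν k - m) / (ν k + m))) s
    have hEu : expEnergy ν c (insert n s) = Ev + 2 * m * û ^ 2 := by linarith
    have hres := resolvent_reflect ν c hν (insert n s) m hm ζ hζ hne (hne n)
    rw [Finset.sum_insert hn (f := fun k => ((c k * ((ν k - m) / (ν k + m)) : ℝ) : ℂ) / (ζ - ν k)),
      ← hmdef, sub_self, zero_div, mul_zero, Complex.ofReal_zero, zero_div, zero_add] at hres
    set Sv := ∑ k ∈ s, ((c k * ((ν k - m) / (ν k + m)) : ℝ) : ℂ) / (ζ - ν k)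
    refine ⟨by rw [hEu]; positivity, ?_⟩
    have hden : 0 < Complex.normSq (ζ - m) := Complex.normSq_pos.2 (hne n)
    set P := ∏ k ∈ s, Complex.normSq (ζ + ν k) / Complex.normSq (ζ - ν k)
    have hP : 1 ≤ P := by
      refine Finset.prod_induction _ (fun x : ℝ => 1 ≤ x)
        (fun _ _ => one_le_mul_of_one_le_of_one_le) le_rfl fun k _ => ?_
      rw [one_le_div (Complex.normSq_pos.2 (hne k)), normSq_add_eq]
      have := mul_pos (hν k) hζ
      linarith
    rw [Finset.prod_insert hn, hEu, hres, ← hmdef]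
    set R := Complex.normSq (ζ + m) / Complex.normSq (ζ - m) with hR
    have hR' : R = 1 + 4 * m * ζ.re / Complex.normSq (ζ - m) := by
      rw [hR, normSq_add_eq]; field_simp
    -- D equals (R - 1)/(2 Re ζ), so K + D collapses to (RP - 1)/(2 Re ζ).
    have key := sq_add_le_of_energy (a := ‖(ζ + m) / (ζ - m) * Sv‖)
      (b := ‖2 * m / (ζ - m) * (û : ℂ)‖) (K := R * ((P - 1) / (2 * ζ.re))) (E := Ev)
      (D := 2 * m / Complex.normSq (ζ - m)) (B := 2 * m * û ^ 2) (by positivity)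
      (by
        have : 0 ≤ P - 1 := by linarith
        have : 0 ≤ R := div_nonneg (Complex.normSq_nonneg _) hden.le
        positivity) hE
      (by
        rw [← Complex.normSq_eq_norm_sq, map_mul, map_div₀, mul_assoc]
        exact mul_le_mul_of_nonneg_left hS (div_nonneg (Complex.normSq_nonneg _) hden.le))
      (by
        rw [← Complex.normSq_eq_norm_sq, map_mul, map_div₀, map_mul, Complex.normSq_ofReal,
          Complex.normSq_ofReal, Complex.normSq_ofNat]
        apply le_of_eq
        field_simp)
      (by positivity)
    rw [Complex.normSq_eq_norm_sq]
    calc _ ≤ _ := pow_le_pow_left₀ (norm_nonneg _) (norm_add_le _ _) 2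
      _ ≤ _ := key
      _ = _ := by
        congr 1
        rw [hR']
        field_simp
        ring

/-! ### Growth of the Blaschke quotient along a ray of slope one -/

lemma normSq_ray_sub (α r l : ℝ) :
    Complex.normSq ((α : ℂ) + r * (1 + Complex.I) - l) = (α + r - l) ^ 2 + r ^ 2 := by
  simp [Complex.normSq_apply]
  ring

/-- With d = l - α the form (r - d)² + r² has smallest eigenvalue (3 - √5)/2 > 1/3. -/
lemma le_normSq_ray_sub (α r l : ℝ) :
    (r ^ 2 + (l - α) ^ 2) / 3 ≤ Complex.normSq ((α : ℂ) + r * (1 + Complex.I) - l) := by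
  rw [normSq_ray_sub]
  nlinarith [sq_nonneg (5 * r - 3 * (l - α)), sq_nonneg (l - α)]

/-- Along the ray `α + 3/2 + r (1 + i)` the Blaschke quotient grows at most subexponentially. -/
theorem exists_prod_blaschke_le (l : ℕ → ℝ) (hl : ∀ k, 0 ≤ l k) (α : ℝ) (hα : 0 < α)
    (hne : ∀ k, l k ≠ α) (hsum : Summable fun k => (l k)⁻¹)
    (htop : Filter.Tendsto l Filter.atTop Filter.atTop) (ε : ℝ) (hε : 0 < ε) :
    ∃ C : ℝ, 0 < C ∧ ∀ (s : Finset ℕ) (r : ℝ), 0 ≤ r →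
      ∏ k ∈ s, Complex.normSq (((α + 3 / 2 : ℝ) : ℂ) + r * (1 + Complex.I) + (l k + 3 / 2 : ℝ)) /
        Complex.normSq (((α + 3 / 2 : ℝ) : ℂ) + r * (1 + Complex.I) - (l k + 3 / 2 : ℝ))
        ≤ C * Real.exp (ε * r) := by
  set A := α + 3 / 2 with hA
  have hA0 : 0 < A := by positivity
  -- Each quotient will be at most exp(t_k), with two bounds for t_k: y_k (A + r), summable in k but
  -- linear in r, and b_k, independent of r. The latter serves on a finite set `s₀`, the former on
  -- the rest, where the y_k add up to less than ε.
  set y : ℕ → ℝ := fun k => 12 * (l k + 3 / 2) / (l k - α) ^ 2 with hy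
  set b : ℕ → ℝ := fun k => 12 * (l k + 3 / 2) * (A / (l k - α) ^ 2 + 1 / |l k - α|) with hb
  have hd : ∀ k, 0 < |l k - α| := fun k => abs_pos.2 (sub_ne_zero.2 (hne k))
  have hy0 : ∀ k, 0 ≤ y k := fun k => by have := hl k; simp only [hy]; positivity
  have hb0 : ∀ k, 0 ≤ b k := fun k => by have := hl k; simp only [hb]; positivity
  have hys : Summable y := by
    refine Summable.of_norm_bounded_eventually_nat (hsum.mul_left 96) ?_
    filter_upwards [htop.eventually_ge_atTop (2 * α), htop.eventually_ge_atTop (3 / 2)]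
      with k h1 h2
    rw [Real.norm_of_nonneg (hy0 k)]
    have h3 : 0 < l k := by linarith
    have h4 : (l k / 2) ^ 2 ≤ (l k - α) ^ 2 := pow_le_pow_left₀ (by positivity) (by linarith) 2
    calc y k ≤ 12 * (l k + l k) / (l k / 2) ^ 2 := by
          simp only [hy]; gcongr
      _ = 96 * (l k)⁻¹ := by field_simp; norm_num
  obtain ⟨s₀, hs₀⟩ := (summable_iff_vanishing_norm.1 hys) ε hε
  refine ⟨Real.exp (∑ k ∈ s₀, b k + ε * A), Real.exp_pos _, fun s r hr => ?_⟩
  set t : ℕ → ℝ := fun k => 12 * (l k + 3 / 2) * (A + r) / (r ^ 2 + (l k - α) ^ 2) with ht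
  have hD : ∀ k, 0 < r ^ 2 + (l k - α) ^ 2 := fun k => by
    have := sq_pos_of_pos (hd k); rw [sq_abs] at this; positivity
  have hR : ∀ k, Complex.normSq ((A : ℂ) + r * (1 + Complex.I) + (l k + 3 / 2 : ℝ)) /
      Complex.normSq ((A : ℂ) + r * (1 + Complex.I) - (l k + 3 / 2 : ℝ)) ≤ Real.exp (t k) := by
    intro k
    have h1 := le_normSq_ray_sub A r (l k + 3 / 2)
    rw [show l k + 3 / 2 - A = l k - α by rw [hA]; ring] at h1
    have h2 : 0 < Complex.normSq ((A : ℂ) + r * (1 + Complex.I) - (l k + 3 / 2 : ℝ)) :=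
      lt_of_lt_of_le (by have := hD k; positivity) h1
    rw [normSq_add_eq, add_div, div_self h2.ne', add_comm]
    refine le_trans ?_ (Real.add_one_le_exp _)
    gcongr
    have h3 : ((A : ℂ) + r * (1 + Complex.I)).re = A + r := by simp
    rw [h3]
    have := hl k
    calc _ ≤ 4 * (l k + 3 / 2) * (A + r) / ((r ^ 2 + (l k - α) ^ 2) / 3) := by
          have := hD k
          gcongr
      _ = t k := by simp only [ht]; field_simp; norm_num
  have ht1 : ∀ k, t k ≤ y k * (A + r) := fun k => by
    have := hl k
    have h1 := sq_pos_of_pos (hd k)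
    rw [sq_abs] at h1
    calc t k ≤ 12 * (l k + 3 / 2) * (A + r) / ((l k - α) ^ 2) := by
          simp only [ht]; gcongr; nlinarith
      _ = _ := by simp only [hy]; ring
  have ht2 : ∀ k, t k ≤ b k := fun k => by
    have := hl k
    have h1 := sq_pos_of_pos (hd k)
    have h0 := hd k
    rw [sq_abs] at h1
    simp only [ht, hb]
    rw [mul_div_assoc, add_div]
    refine mul_le_mul_of_nonneg_left (add_le_add ?_ ?_) (by positivity)
    · gcongr
      nlinarith
    · rw [div_le_div_iff₀ (hD k) h0, ← sq_abs (l k - α)]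
      nlinarith [sq_nonneg (r - |l k - α|), mul_nonneg hr h0.le]
  calc _ ≤ ∏ k ∈ s, Real.exp (t k) := Finset.prod_le_prod
        (fun k _ => div_nonneg (Complex.normSq_nonneg _) (Complex.normSq_nonneg _))
        fun k _ => hR k
    _ = Real.exp (∑ k ∈ s, t k) := (Real.exp_sum _ _).symm
    _ ≤ Real.exp (∑ k ∈ s₀, b k + ε * (A + r)) := by
        gcongr
        rw [← Finset.sum_inter_add_sum_sdiff s s₀]
        gcongr ?_ + ?_
        · calc _ ≤ ∑ k ∈ s ∩ s₀, b k := Finset.sum_le_sum fun k _ => ht2 k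
            _ ≤ _ := Finset.sum_le_sum_of_subset_of_nonneg Finset.inter_subset_right
              fun k _ _ => hb0 k
        · calc _ ≤ ∑ k ∈ s \ s₀, y k * (A + r) := Finset.sum_le_sum fun k _ => ht1 k
            _ = (∑ k ∈ s \ s₀, y k) * (A + r) := by rw [Finset.sum_mul]
            _ ≤ _ := by
              gcongr
              exact (le_abs_self _).trans (hs₀ _ Finset.sdiff_disjoint).le
    _ = _ := by rw [← Real.exp_add]; congr 1; ring

/-! ### A ray integral that separates positive from negative rates -/

/-- The integrand of the ray integral `∫ exp (-s ζ) / (ζ - τ) dζ` along `ζ = r (1 + i)`. -/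
noncomputable def rayKernel (τ s r : ℝ) : ℂ :=
  Complex.exp (-(s * (1 + Complex.I)) * r) * (1 + Complex.I) / (r * (1 + Complex.I) - τ)

lemma ray_sub_bound (r τ : ℝ) : |τ| / 2 ≤ ‖(r : ℂ) * (1 + Complex.I) - τ‖ := by
  have h := le_normSq_ray_sub 0 r τ
  simp only [Complex.ofReal_zero, zero_add, sub_zero] at h
  rw [Complex.normSq_eq_norm_sq] at h
  refine abs_le_of_sq_le_sq' ?_ (norm_nonneg _) |>.2
  rw [div_pow, sq_abs]
  nlinarith [sq_nonneg τ, sq_nonneg r]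

lemma ray_sub_ne_zero (r : ℝ) {τ : ℝ} (hτ : τ ≠ 0) : (r : ℂ) * (1 + Complex.I) - τ ≠ 0 := by
  have h := ray_sub_bound r τ
  have h1 := abs_pos.2 hτ
  exact norm_pos_iff.1 (lt_of_lt_of_le (by positivity) h)

lemma norm_one_add_I_le : ‖(1 + Complex.I : ℂ)‖ ≤ 2 :=
  (norm_add_le _ _).trans (by simp; norm_num)

lemma one_add_I_ne_zero : (1 + Complex.I : ℂ) ≠ 0 := fun h => by
  have := congrArg Complex.re h
  simp at this

lemma norm_exp_ray (s r : ℝ) :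
    ‖Complex.exp (-(s * (1 + Complex.I)) * r)‖ = Real.exp (-s * r) := by
  rw [Complex.norm_exp]
  simp

lemma norm_rayKernel_le {τ : ℝ} (hτ : τ ≠ 0) (s r : ℝ) :
    ‖rayKernel τ s r‖ ≤ 4 / |τ| * Real.exp (-s * r) := by
  have h1 := abs_pos.2 hτ
  unfold rayKernel
  rw [norm_div, norm_mul, norm_exp_ray]
  calc _ ≤ Real.exp (-s * r) * 2 / (|τ| / 2) := by
        gcongr
        · exact norm_one_add_I_le
        · exact ray_sub_bound r τ
    _ = _ := by field_simp; norm_num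

lemma continuous_rayKernel {τ : ℝ} (hτ : τ ≠ 0) (s : ℝ) : Continuous (rayKernel τ s) := by
  unfold rayKernel
  refine Continuous.div (by fun_prop) (by fun_prop) fun r => ray_sub_ne_zero r hτ

lemma integrableOn_exp_neg_mul {s : ℝ} (hs : 0 < s) :
    IntegrableOn (fun r : ℝ => Real.exp (-s * r)) (Set.Ioi 0) :=
  exp_neg_integrableOn_Ioi 0 hs

lemma integrable_rayKernel {τ : ℝ} (hτ : τ ≠ 0) {s : ℝ} (hs : 0 < s) :
    IntegrableOn (rayKernel τ s) (Set.Ioi 0) :=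
  ((integrableOn_exp_neg_mul hs).const_mul (4 / |τ|)).mono'
    (continuous_rayKernel hτ s).aestronglyMeasurable
    (Filter.Eventually.of_forall fun r => norm_rayKernel_le hτ s r)

/-- The ray integral `∫ exp (-s ζ) / (ζ - τ) dζ` along `ζ = r (1 + i)`, `r > 0`. -/
noncomputable def rayIntegral (τ s : ℝ) : ℂ := ∫ r in Set.Ioi (0 : ℝ), rayKernel τ s r

lemma integrable_exp_ray {s : ℝ} (hs : 0 < s) :
    IntegrableOn (fun r : ℝ => Complex.exp (-(s * (1 + Complex.I)) * r)) (Set.Ioi 0) :=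
  integrableOn_exp_mul_complex_Ioi (by simpa using hs) 0

lemma integral_exp_ray {s : ℝ} (hs : 0 < s) :
    ∫ r in Set.Ioi (0 : ℝ), Complex.exp (-(s * (1 + Complex.I)) * r) * (1 + Complex.I)
      = (1 / s : ℝ) := by
  rw [integral_mul_const, integral_exp_mul_complex_Ioi (by simpa using hs)]
  have := one_add_I_ne_zero
  have h2 : (s : ℂ) ≠ 0 := by exact_mod_cast hs.ne'
  simp
  field_simp

/-- Differentiation brings down -ζ, and ζ/(ζ - τ) = 1 + τ/(ζ - τ). The inhomogeneous term -1/s is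
real, so the imaginary part solves y' = -τ y and no contour has to be moved. -/
lemma hasDerivAt_rayIntegral {τ : ℝ} (hτ : τ ≠ 0) {s : ℝ} (hs : 0 < s) :
    HasDerivAt (rayIntegral τ) (-(1 / s : ℝ) - τ * rayIntegral τ s) s := by
  set F' : ℝ → ℝ → ℂ := fun s r =>
    -(Complex.exp (-(s * (1 + Complex.I)) * r) * (1 + Complex.I)) - τ * rayKernel τ s r with hF'
  have key := hasDerivAt_integral_of_dominated_loc_of_deriv_le
    (μ := volume.restrict (Set.Ioi (0 : ℝ))) (F := rayKernel τ) (F' := F') (x₀ := s)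
    (s := Set.Ioi (s / 2)) (bound := fun r => 6 * Real.exp (-(s / 2) * r))
    (Ioi_mem_nhds (by linarith))
    (Filter.Eventually.of_forall fun x => (continuous_rayKernel hτ x).aestronglyMeasurable)
    (integrable_rayKernel hτ hs)
    (by
      have := continuous_rayKernel hτ s
      exact Continuous.aestronglyMeasurable (by simp only [hF']; fun_prop))
    (by
      filter_upwards [ae_restrict_mem measurableSet_Ioi] with r hr x hx
      have hr : 0 < r := hr
      have hx : s / 2 < x := hx
      have h1 : ‖Complex.exp (-(x * (1 + Complex.I)) * r) * (1 + Complex.I)‖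
          ≤ 2 * Real.exp (-x * r) := by
        rw [norm_mul, norm_exp_ray, mul_comm]
        gcongr
        exact norm_one_add_I_le
      have h2 : ‖(τ : ℂ) * rayKernel τ x r‖ ≤ 4 * Real.exp (-x * r) := by
        rw [norm_mul, Complex.norm_real, Real.norm_eq_abs]
        have h3 := abs_pos.2 hτ
        calc _ ≤ |τ| * (4 / |τ| * Real.exp (-x * r)) := by
              gcongr; exact norm_rayKernel_le hτ x r
          _ = _ := by field_simp
      have h4 : Real.exp (-x * r) ≤ Real.exp (-(s / 2) * r) := by
        gcongr
      calc ‖F' x r‖ ≤ _ := norm_sub_le _ _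
        _ ≤ _ := by rw [norm_neg]; linarith)
    ((integrableOn_exp_neg_mul (by positivity)).const_mul 6)
    (by
      refine Filter.Eventually.of_forall fun r x _ => ?_
      have h1 : HasDerivAt (fun x : ℝ => -((x : ℂ) * (1 + Complex.I)) * r)
          (-(1 * (1 + Complex.I)) * r) x := by
        exact ((Complex.ofRealCLM.hasDerivAt (x := x)).mul_const _).neg.mul_const _
      have h2 := (h1.cexp.mul_const (1 + Complex.I)).div_const ((r : ℂ) * (1 + Complex.I) - τ)
      refine h2.congr_deriv ?_
      have h3 := ray_sub_ne_zero r hτ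
      have h4 : (r : ℂ) * (1 + Complex.I) / (r * (1 + Complex.I) - τ)
          = 1 + τ / (r * (1 + Complex.I) - τ) := by
        rw [← sub_eq_iff_eq_add, ← sub_div, div_self h3]
      simp only [hF', rayKernel]
      linear_combination
        (-(Complex.exp (-(x * (1 + Complex.I)) * r) * (1 + Complex.I))) * h4)
  refine key.2.congr_deriv ?_
  simp only [hF']
  have h1 : Integrable (fun r : ℝ => -(Complex.exp (-(s * (1 + Complex.I)) * r) *
      (1 + Complex.I))) (volume.restrict (Set.Ioi 0)) :=
    ((integrable_exp_ray hs).mul_const _).neg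
  rw [integral_sub h1 ((integrable_rayKernel hτ hs).const_mul _), integral_neg,
    integral_exp_ray hs, integral_const_mul]
  rfl

lemma hasDerivAt_rayIntegral_im {τ : ℝ} (hτ : τ ≠ 0) {s : ℝ} (hs : 0 < s) :
    HasDerivAt (fun s => (rayIntegral τ s).im) (-τ * (rayIntegral τ s).im) s := by
  have h := Complex.imCLM.hasFDerivAt.comp_hasDerivAt s (hasDerivAt_rayIntegral hτ hs)
  refine h.congr_deriv ?_
  simp

lemma rayIntegral_im_eq {τ : ℝ} (hτ : τ ≠ 0) {s : ℝ} (hs : 0 < s) :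
    (rayIntegral τ s).im = (rayIntegral τ 1).im * Real.exp (-τ * (s - 1)) := by
  set g : ℝ → ℝ := fun s => (rayIntegral τ s).im * Real.exp (τ * (s - 1)) with hg
  have hd : ∀ x ∈ Set.Ioi (0 : ℝ), HasDerivAt g 0 x := fun x hx => by
    have h1 : HasDerivAt (fun s : ℝ => τ * (s - 1)) (τ * 1) x :=
      ((hasDerivAt_id x).sub_const 1).const_mul τ
    refine ((hasDerivAt_rayIntegral_im hτ hx).mul h1.exp).congr_deriv ?_
    ring
  have := isOpen_Ioi.is_const_of_deriv_eq_zero (isPreconnected_Ioi (a := (0 : ℝ)))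
    (fun x hx => (hd x hx).differentiableAt.differentiableWithinAt)
    (fun x hx => (hd x hx).deriv) hs (show (1 : ℝ) ∈ Set.Ioi 0 by simp)
  simp only [hg, sub_self, mul_zero, Real.exp_zero, mul_one] at this
  rw [← this, mul_assoc, ← Real.exp_add]
  simp

/-- A nonzero multiple of exp(-τ s) would grow as s → ∞, whereas the integral is O(1/s). -/
lemma rayIntegral_im_of_neg {τ : ℝ} (hτ : τ < 0) {s : ℝ} (hs : 0 < s) :
    (rayIntegral τ s).im = 0 := by
  have hb : ∀ s : ℝ, 0 < s → |(rayIntegral τ s).im| ≤ 4 / |τ| * (1 / s) := fun s hs => by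
    refine (Complex.abs_im_le_norm _).trans ((norm_integral_le_integral_norm _).trans ?_)
    calc _ ≤ ∫ r in Set.Ioi (0 : ℝ), 4 / |τ| * Real.exp (-s * r) :=
          integral_mono (integrable_rayKernel hτ.ne hs).norm
            ((integrableOn_exp_neg_mul hs).const_mul _) fun r => norm_rayKernel_le hτ.ne s r
      _ = _ := by
        rw [integral_const_mul]
        congr 1
        rw [integral_exp_mul_Ioi (by linarith)]
        simp
  have hlim : Filter.Tendsto (fun s : ℝ => 4 / |τ| * (1 / s)) Filter.atTop (nhds 0) := by
    simpa using (tendsto_inv_atTop_zero (𝕜 := ℝ)).const_mul (4 / |τ|)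
  have h1 : |(rayIntegral τ 1).im| ≤ 0 := by
    refine ge_of_tendsto hlim ?_
    filter_upwards [Filter.eventually_ge_atTop 1] with x hx
    refine le_trans ?_ (hb x (by linarith))
    rw [rayIntegral_im_eq hτ.ne (by linarith : 0 < x), abs_mul, Real.abs_exp]
    refine le_mul_of_one_le_right (abs_nonneg _) (Real.one_le_exp ?_)
    nlinarith
  rw [rayIntegral_im_eq hτ.ne hs, abs_nonpos_iff.1 h1, zero_mul]

/-- The substitution r ↦ τ r leaves one universal constant, that of τ = 1, for all τ > 0. -/
lemma rayIntegral_scale {τ : ℝ} (hτ : 0 < τ) (s : ℝ) :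
    rayIntegral τ s = rayIntegral 1 (τ * s) := by
  unfold rayIntegral
  have h := integral_comp_mul_left_Ioi (rayKernel τ s) 0 hτ
  rw [mul_zero] at h
  have h2 : ∀ r, rayKernel 1 (τ * s) r = τ • rayKernel τ s (τ * r) := fun r => by
    have h3 := ray_sub_ne_zero r one_ne_zero
    have h4 := ray_sub_ne_zero (τ * r) hτ.ne'
    have h5 : (τ : ℂ) ≠ 0 := by exact_mod_cast hτ.ne'
    unfold rayKernel
    rw [Complex.real_smul]
    push_cast at *
    rw [show -((τ : ℂ) * s * (1 + Complex.I)) * r = -(s * (1 + Complex.I)) * (τ * r) by ring]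
    field_simp
  simp_rw [h2]
  rw [integral_smul, h, smul_smul, mul_inv_cancel₀ hτ.ne', one_smul]

lemma le_norm_ray_sq_sub (r : ℝ) :
    (1 + r ^ 2) / 2 ≤ ‖((r : ℂ) * (1 + Complex.I)) ^ 2 - 1‖ := by
  have h : Complex.normSq (((r : ℂ) * (1 + Complex.I)) ^ 2 - 1) = 4 * r ^ 4 + 1 := by
    simp [Complex.normSq_apply, sq]
    ring
  rw [Complex.normSq_eq_norm_sq] at h
  refine abs_le_of_sq_le_sq' ?_ (norm_nonneg _) |>.2
  rw [h]
  nlinarith [sq_nonneg (r ^ 2 - 1), sq_nonneg (r ^ 2)]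

lemma im_ray_sq_sub_neg (r : ℝ) :
    ((1 + Complex.I) / (((r : ℂ) * (1 + Complex.I)) ^ 2 - 1)).im < 0 := by
  have h : Complex.normSq (((r : ℂ) * (1 + Complex.I)) ^ 2 - 1) = 4 * r ^ 4 + 1 := by
    simp [Complex.normSq_apply, sq]
    ring
  rw [Complex.div_im, h, ← sub_div]
  apply div_neg_of_neg_of_pos _ (by positivity)
  simp [sq]
  nlinarith [sq_nonneg r]

/-- Otherwise the imaginary parts for τ = 1 and τ = -1 would both vanish for every s > 0. Half their
difference has the factor 1/(ζ² - 1), absolutely integrable down to s = 0, where ζ² = 2ir² makes the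
imaginary part of the integrand strictly negative. -/
theorem rayIntegral_one_im_ne_zero : (rayIntegral 1 1).im ≠ 0 := by
  intro h0
  set g : ℝ → ℝ → ℂ := fun s r => Complex.exp (-(s * (1 + Complex.I)) * r) *
    ((1 + Complex.I) / ((r * (1 + Complex.I)) ^ 2 - 1)) with hg
  have hne : ∀ r : ℝ, ((r : ℂ) * (1 + Complex.I)) ^ 2 - 1 ≠ 0 := fun r =>
    norm_pos_iff.1 (lt_of_lt_of_le (by positivity) (le_norm_ray_sq_sub r))
  have hcont : ∀ s, Continuous (g s) := fun s => by
    simp only [hg]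
    exact Continuous.mul (by fun_prop) (Continuous.div (by fun_prop) (by fun_prop) hne)
  have hbound : ∀ s, 0 ≤ s → ∀ r ∈ Set.Ioi (0 : ℝ), ‖g s r‖ ≤ 4 * (1 + r ^ 2)⁻¹ := by
    intro s hs r hr
    have hr : 0 < r := hr
    simp only [hg]
    rw [norm_mul, norm_exp_ray, norm_div]
    calc _ ≤ 1 * (2 / ((1 + r ^ 2) / 2)) := by
          gcongr
          · exact Real.exp_le_one_iff.2 (by nlinarith)
          · exact norm_one_add_I_le
          · exact le_norm_ray_sq_sub r
      _ = _ := by field_simp; norm_num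
  have hbi : Integrable (fun r : ℝ => 4 * (1 + r ^ 2)⁻¹) (volume.restrict (Set.Ioi 0)) :=
    (integrable_inv_one_add_sq.const_mul 4).restrict
  have hint : Integrable (g 0) (volume.restrict (Set.Ioi 0)) :=
    hbi.mono' (hcont 0).aestronglyMeasurable
      ((ae_restrict_mem measurableSet_Ioi).mono (hbound 0 le_rfl))
  have hlim : Filter.Tendsto (fun s => (∫ r in Set.Ioi (0 : ℝ), g s r).im)
      (nhdsWithin 0 (Set.Ioi 0)) (nhds (∫ r in Set.Ioi (0 : ℝ), g 0 r).im) := by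
    refine (Complex.continuous_im.tendsto _).comp ?_
    refine tendsto_integral_filter_of_dominated_convergence _
      (Filter.Eventually.of_forall fun s => (hcont s).aestronglyMeasurable) ?_ hbi ?_
    · filter_upwards [self_mem_nhdsWithin] with s hs
      exact (ae_restrict_mem measurableSet_Ioi).mono (hbound s (le_of_lt hs))
    · refine Filter.Eventually.of_forall fun r => ?_
      have : Continuous fun s => g s r := by simp only [hg]; fun_prop
      exact (this.tendsto 0).mono_left nhdsWithin_le_nhds
  have hzero : ∀ s ∈ Set.Ioi (0 : ℝ), (∫ r in Set.Ioi (0 : ℝ), g s r).im = 0 := by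
    intro s hs
    have hs : 0 < s := hs
    have h1 : ∀ r, g s r = (1 / 2 : ℝ) • (rayKernel 1 s r - rayKernel (-1) s r) := fun r => by
      have h2 := ray_sub_ne_zero r one_ne_zero
      have h3 := ray_sub_ne_zero r (neg_ne_zero.2 (one_ne_zero (α := ℝ)))
      have h4 := hne r
      have h5 : ∀ w : ℂ, w - (1 : ℝ) ≠ 0 → w - (-1 : ℝ) ≠ 0 →
          1 / (w ^ 2 - 1) = 1 / 2 * (1 / (w - (1 : ℝ)) - 1 / (w - (-1 : ℝ))) := by
        intro w h1 h2
        rw [show w ^ 2 - 1 = (w - (1 : ℝ)) * (w - (-1 : ℝ)) by push_cast; ring]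
        rw [div_sub_div _ _ h1 h2]
        field_simp
        push_cast
        ring
      simp only [hg, rayKernel]
      rw [Complex.real_smul]
      push_cast at h5 ⊢
      linear_combination (Complex.exp (-(s * (1 + Complex.I)) * r) * (1 + Complex.I)) *
        h5 _ (by simpa using h2) (by simpa using h3)
    simp_rw [h1]
    rw [integral_smul, integral_sub (integrable_rayKernel one_ne_zero hs)
      (integrable_rayKernel (neg_ne_zero.2 one_ne_zero) hs), Complex.smul_im, Complex.sub_im]
    have h2 := rayIntegral_im_eq one_ne_zero hs
    have h3 := rayIntegral_im_of_neg (τ := -1) (by norm_num) hs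
    rw [h0, zero_mul] at h2
    unfold rayIntegral at h2 h3
    rw [h2, h3]
    simp
  have h1 : (∫ r in Set.Ioi (0 : ℝ), g 0 r).im = 0 := by
    refine tendsto_nhds_unique hlim (tendsto_const_nhds.congr' ?_)
    filter_upwards [self_mem_nhdsWithin] with s hs
    exact (hzero s hs).symm
  have h2 : ∀ r, (g 0 r).im < 0 := fun r => by
    simpa [hg] using im_ray_sq_sub_neg r
  have h3 : ∫ r in Set.Ioi (0 : ℝ), -(g 0 r).im = 0 := by
    rw [integral_neg, neg_eq_zero]
    exact (Complex.imCLM.integral_comp_comm hint).trans h1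
  have hint' : Integrable (fun r => -(g 0 r).im) (volume.restrict (Set.Ioi 0)) :=
    (Complex.imCLM.integrable_comp hint).neg
  have h4 := (integral_pos_iff_support_of_nonneg (fun r => (neg_pos.2 (h2 r)).le) hint').2 (by
    rw [Set.eq_univ_of_forall (s := Function.support fun r => -(g 0 r).im)
      fun r => (neg_pos.2 (h2 r)).ne']
    simp)
  exact h4.ne' h3

/-- The ray integral reproduces `exp (-τ s)` for `τ > 0` and annihilates `τ < 0`. -/
theorem rayIntegral_im {τ : ℝ} (hτ : τ ≠ 0) {s : ℝ} (hs : 0 < s) :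
    (rayIntegral τ s).im = if 0 < τ then
      (rayIntegral 1 1).im * Real.exp 1 * Real.exp (-τ * s) else 0 := by
  split_ifs with h
  · rw [rayIntegral_scale h, rayIntegral_im_eq one_ne_zero (mul_pos h hs), mul_assoc,
      ← Real.exp_add]
    congr 2
    ring
  · exact rayIntegral_im_of_neg (lt_of_le_of_ne (not_lt.1 h) hτ) hs

/-! ### Reproducing formula and uniform modulus of continuity -/

/-- The power `x ^ (α + r (1 + i))`. -/
noncomputable def rayPow (α x r : ℝ) : ℂ := (x : ℂ) ^ ((α : ℂ) + r * (1 + Complex.I))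

lemma rayPow_zero {α r : ℝ} (hα : 0 < α) (hr : 0 ≤ r) : rayPow α 0 r = 0 := by
  unfold rayPow
  rw [Complex.ofReal_zero, Complex.zero_cpow]
  intro h
  have := congrArg Complex.re h
  simp at this
  linarith

lemma rayPow_eq {α x : ℝ} (hx : 0 < x) (r : ℝ) :
    rayPow α x r = (x ^ α : ℝ) *
      Complex.exp (-((-Real.log x : ℝ) * (1 + Complex.I)) * r) := by
  unfold rayPow
  have hx' : (x : ℂ) ≠ 0 := by exact_mod_cast hx.ne'
  rw [Complex.cpow_add _ _ hx', ← Complex.ofReal_cpow hx.le, Complex.cpow_def_of_ne_zero hx',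
    ← Complex.ofReal_log hx.le]
  congr 2
  push_cast
  ring

lemma norm_rayPow_le {α x ρ r : ℝ} (hα : 0 < α) (hr : 0 ≤ r) (hx : x ∈ Set.Icc 0 ρ) (hρ : 0 < ρ)
    (hρ1 : ρ < 1) : ‖rayPow α x r‖ ≤ Real.exp (Real.log ρ * r) := by
  rcases hx.1.eq_or_lt with h | h
  · rw [← h, rayPow_zero hα hr, norm_zero]
    positivity
  · unfold rayPow
    rw [Complex.norm_cpow_eq_rpow_re_of_pos h]
    have : ((α : ℂ) + r * (1 + Complex.I)).re = α + r := by simp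
    rw [this, ← Real.rpow_def_of_pos hρ]
    calc x ^ (α + r) ≤ ρ ^ (α + r) := Real.rpow_le_rpow hx.1 hx.2 (by positivity)
      _ ≤ ρ ^ r := Real.rpow_le_rpow_of_exponent_ge hρ hρ1.le (by linarith)

lemma measurable_rayPow (α x : ℝ) : Measurable (rayPow α x) := by
  unfold rayPow
  fun_prop

lemma continuous_rayPow {α r : ℝ} (hα : 0 < α) (hr : 0 ≤ r) :
    Continuous fun x => rayPow α x r :=
  continuous_iff_continuousAt.2 fun x =>
    Complex.continuousAt_ofReal_cpow_const x _ (Or.inl (by simp; positivity))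

/-- The functional `∑ c_k / (α + r (1 + i) - l_k)` with `c_k = b_k / (l_k + 1)`. -/
noncomputable def raySum (l b : ℕ → ℝ) (s : Finset ℕ) (α r : ℝ) : ℂ :=
  ∑ k ∈ s, ((b k / (l k + 1) : ℝ) : ℂ) / ((α : ℂ) + r * (1 + Complex.I) - l k)

/-- The integrand which reproduces the part of a Müntz polynomial with exponents above `α`. -/
noncomputable def rayIntegrand (l b : ℕ → ℝ) (s : Finset ℕ) (α x r : ℝ) : ℂ :=
  (1 + Complex.I) * (α + 1 + r * (1 + Complex.I)) * rayPow α x r * raySum l b s α r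

/-- The constant in the reproducing formula along the ray. -/
noncomputable def rayConst : ℝ := (rayIntegral 1 1).im * Real.exp 1

lemma rayConst_ne_zero : rayConst ≠ 0 :=
  mul_ne_zero rayIntegral_one_im_ne_zero (Real.exp_pos _).ne'

theorem integral_rayIntegrand_im (l b : ℕ → ℝ) (hl : ∀ k, 0 ≤ l k) {α : ℝ} (hα : 0 < α)
    (hne : ∀ k, l k ≠ α) (s : Finset ℕ) {x : ℝ} (hx0 : 0 ≤ x) (hx1 : x < 1) :
    (∫ r in Set.Ioi (0 : ℝ), rayIntegrand l b s α x r).im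
      = rayConst * ∑ k ∈ s with α < l k, b k * x ^ l k := by
  rcases hx0.eq_or_lt with h | hx
  · subst h
    rw [setIntegral_congr_fun (g := fun _ => 0) measurableSet_Ioi, integral_zero,
      Finset.sum_eq_zero, mul_zero, Complex.zero_im]
    · intro k hk
      rw [Real.zero_rpow (hα.trans (Finset.mem_filter.1 hk).2).ne', mul_zero]
    · intro r hr
      simp [rayIntegrand, rayPow_zero hα (le_of_lt hr)]
  · have hs : 0 < -Real.log x := by linarith [Real.log_neg hx hx1]
    set t := -Real.log x with ht
    have hτ : ∀ k, l k - α ≠ 0 := fun k => sub_ne_zero.2 (hne k)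
    have h1 : ∀ r, rayIntegrand l b s α x r = ∑ k ∈ s, ((b k / (l k + 1) * x ^ α : ℝ) : ℂ) *
        (Complex.exp (-(t * (1 + Complex.I)) * r) * (1 + Complex.I)
          + ((l k + 1 : ℝ) : ℂ) * rayKernel (l k - α) t r) := fun r => by
      unfold rayIntegrand raySum
      rw [Finset.mul_sum]
      refine Finset.sum_congr rfl fun k _ => ?_
      rw [rayPow_eq hx, ← ht]
      have h2 := ray_sub_ne_zero r (hτ k)
      have h3 : ((α : ℂ) + r * (1 + Complex.I) - l k)
          = r * (1 + Complex.I) - (l k - α : ℝ) := by push_cast; ring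
      -- The factor ζ + 1 undoes the integration: its summand 1 contributes a real integral, and l_k
      -- + 1 cancels the denominator in `raySum`.
      have h4 : ((α : ℂ) + 1 + r * (1 + Complex.I)) / (r * (1 + Complex.I) - (l k - α : ℝ))
          = 1 + ((l k + 1 : ℝ) : ℂ) / (r * (1 + Complex.I) - (l k - α : ℝ)) := by
        rw [← sub_eq_iff_eq_add, ← sub_div, div_eq_one_iff_eq h2]
        push_cast; ring
      rw [h3]
      simp only [rayKernel]
      rw [Complex.ofReal_mul]
      linear_combination ((1 + Complex.I) * (((x ^ α : ℝ) : ℂ) *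
        Complex.exp (-(t * (1 + Complex.I)) * r)) * ((b k / (l k + 1) : ℝ) : ℂ)) * h4
    have hi1 : IntegrableOn (fun r : ℝ => Complex.exp (-(t * (1 + Complex.I)) * r) *
      (1 + Complex.I)) (Set.Ioi 0) := (integrable_exp_ray hs).mul_const _
    have hi2 : ∀ k, IntegrableOn (fun r : ℝ => ((l k + 1 : ℝ) : ℂ) * rayKernel (l k - α) t r)
      (Set.Ioi 0) := fun k => (integrable_rayKernel (hτ k) hs).const_mul _
    have hi3 : ∀ k ∈ s, IntegrableOn (fun r : ℝ => ((b k / (l k + 1) * x ^ α : ℝ) : ℂ) *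
        (Complex.exp (-(t * (1 + Complex.I)) * r) * (1 + Complex.I)
          + ((l k + 1 : ℝ) : ℂ) * rayKernel (l k - α) t r)) (Set.Ioi 0) :=
      fun k _ => (hi1.add (hi2 k)).const_mul _
    simp_rw [h1]
    rw [integral_finsetSum _ hi3, Complex.im_sum,
      Finset.mul_sum, Finset.sum_filter]
    refine Finset.sum_congr rfl fun k _ => ?_
    rw [integral_const_mul, integral_add hi1 (hi2 k), integral_exp_ray hs, integral_const_mul,
      Complex.im_ofReal_mul, Complex.add_im, Complex.ofReal_im, zero_add, Complex.im_ofReal_mul]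
    have h5 := rayIntegral_im (hτ k) hs
    unfold rayIntegral at h5
    rw [h5]
    have hk : l k + 1 ≠ 0 := by have := hl k; positivity
    simp only [sub_pos]
    split_ifs with h6
    · have h7 : x ^ l k = x ^ α * Real.exp (-(l k - α) * t) := by
        rw [Real.rpow_def_of_pos hx, Real.rpow_def_of_pos hx, ← Real.exp_add, ht]
        congr 1; ring
      rw [h7]
      unfold rayConst rayIntegral
      field_simp
    · simp

/-- Shifting both ζ and the exponents by 3/2 preserves ζ - l_k and puts the sum in the form of
`normSq_resolvent_le`. The growth rate 2ε of the Blaschke quotient becomes ε after a square root. -/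
lemma norm_raySum_le (l : ℕ → ℝ) (hl : ∀ k, 0 ≤ l k) {α : ℝ} (hα : 0 < α)
    (hne : ∀ k, l k ≠ α) (hsum : Summable fun k => (l k)⁻¹)
    (htop : Filter.Tendsto l Filter.atTop Filter.atTop) {ε : ℝ} (hε : 0 < ε) :
    ∃ C : ℝ, 0 < C ∧ ∀ (b : ℕ → ℝ) (s : Finset ℕ) (r : ℝ), 0 ≤ r →
      ‖raySum l b s α r‖ ≤ C * Real.exp (ε * r) *
        √(expEnergy (fun k => l k + 3 / 2) (fun k => b k / (l k + 1)) s) := by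
  obtain ⟨C, hC, hCb⟩ := exists_prod_blaschke_le l hl α hα hne hsum htop (2 * ε) (by positivity)
  refine ⟨√C, Real.sqrt_pos.2 hC, fun b s r hr => ?_⟩
  have hre : (((α + 3 / 2 : ℝ) : ℂ) + r * (1 + Complex.I)).re = α + 3 / 2 + r := by simp
  have hsub : ∀ k, ((α + 3 / 2 : ℝ) : ℂ) + r * (1 + Complex.I) - (l k + 3 / 2 : ℝ)
      = (α : ℂ) + r * (1 + Complex.I) - l k := fun k => by push_cast; ring
  obtain ⟨hE, hS⟩ := normSq_resolvent_le (fun k => l k + 3 / 2) (fun k => by have := hl k; positivity)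
    (((α + 3 / 2 : ℝ) : ℂ) + r * (1 + Complex.I)) (by rw [hre]; positivity)
    (fun k => by
      rw [hsub, show (α : ℂ) + r * (1 + Complex.I) - l k
        = r * (1 + Complex.I) - (l k - α : ℝ) by push_cast; ring]
      exact ray_sub_ne_zero r (sub_ne_zero.2 (hne k))) s (fun k => b k / (l k + 1))
  set E := expEnergy (fun k => l k + 3 / 2) (fun k => b k / (l k + 1)) s
  have hP := hCb s r hr
  rw [hre] at hS
  simp only [hsub] at hS hP
  set P := ∏ k ∈ s, Complex.normSq (((α + 3 / 2 : ℝ) : ℂ) + r * (1 + Complex.I) + (l k + 3 / 2 : ℝ)) /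
        Complex.normSq ((α : ℂ) + r * (1 + Complex.I) - l k)
  have hP0 : 0 ≤ P := Finset.prod_nonneg fun k _ =>
    div_nonneg (Complex.normSq_nonneg _) (Complex.normSq_nonneg _)
  have h1 : (P - 1) / (2 * (α + 3 / 2 + r)) ≤ P := by
    rw [div_le_iff₀ (by positivity)]
    nlinarith
  rw [Complex.normSq_eq_norm_sq] at hS
  have h2 : ‖raySum l b s α r‖ ^ 2 ≤ (√C * Real.exp (ε * r) * √E) ^ 2 := by
    rw [mul_pow, mul_pow, Real.sq_sqrt hC.le, Real.sq_sqrt hE, ← Real.exp_nat_mul]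
    calc _ ≤ _ := hS
      _ ≤ P * E := by gcongr
      _ ≤ _ := by
        gcongr
        refine hP.trans (le_of_eq ?_)
        congr 2
        push_cast; ring
  exact (sq_le_sq₀ (norm_nonneg _) (by positivity)).1 h2

lemma exists_linear_le_exp {a c δ : ℝ} (ha : 0 ≤ a) (hc : 0 ≤ c) (hδ : 0 < δ) :
    ∃ K : ℝ, 0 ≤ K ∧ ∀ r, 0 ≤ r → a + c * r ≤ K * Real.exp (δ * r) := by
  refine ⟨a + c / δ, by positivity, fun r hr => ?_⟩
  have h1 : 1 ≤ Real.exp (δ * r) := Real.one_le_exp (by positivity)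
  have h2 : δ * r ≤ Real.exp (δ * r) := by linarith [Real.add_one_le_exp (δ * r)]
  have h3 : c * r = c / δ * (δ * r) := by field_simp
  rw [h3, add_mul]
  gcongr
  exact le_mul_of_one_le_right ha h1

/-- A common modulus of continuity on `[0, ρ]`, `ρ < 1`, for the parts with exponents above `α`
of the Müntz polynomials of bounded energy. -/
theorem exists_modulus (l : ℕ → ℝ) (hl : ∀ k, 0 ≤ l k) {α : ℝ} (hα : 0 < α)
    (hne : ∀ k, l k ≠ α) (hsum : Summable fun k => (l k)⁻¹)
    (htop : Filter.Tendsto l Filter.atTop Filter.atTop) {ρ : ℝ} (hρ : 0 < ρ) (hρ1 : ρ < 1) :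
    ∃ (W : ℝ → ℝ → ℝ) (B : ℝ), (∀ x ∈ Set.Icc 0 ρ, ∀ y ∈ Set.Icc 0 ρ, W x y ≤ B) ∧
      (∀ x ∈ Set.Icc 0 ρ, Filter.Tendsto (W x) (nhdsWithin x (Set.Icc 0 ρ)) (nhds 0)) ∧
      ∀ (b : ℕ → ℝ) (s : Finset ℕ), ∀ x ∈ Set.Icc 0 ρ, ∀ y ∈ Set.Icc 0 ρ,
        |∑ k ∈ s with α < l k, b k * x ^ l k - ∑ k ∈ s with α < l k, b k * y ^ l k| ≤
          W x y * √(expEnergy (fun k => l k + 3 / 2) (fun k => b k / (l k + 1)) s) := by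
  set δ := -Real.log ρ with hδ
  have hδ0 : 0 < δ := by linarith [Real.log_neg hρ hρ1]
  -- Against the decay exp(-δ r) of x^ζ on [0, ρ], δ/4 is spent on `raySum` and δ/4 on the linear
  -- factor ζ + 1; exp(-δ r/2) remains.
  obtain ⟨C, hC, hS⟩ := norm_raySum_le l hl hα hne hsum htop (ε := δ / 4) (by positivity)
  obtain ⟨K, hK, hKb⟩ := exists_linear_le_exp (a := 2 * (α + 1)) (c := 4) (δ := δ / 4)
    (by positivity) (by norm_num) (by positivity)
  set D : ℝ → ℝ := fun r => K * C * Real.exp (δ / 2 * r) with hD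
  have hDc : Continuous D := by simp only [hD]; fun_prop
  have hD0 : ∀ r, 0 ≤ D r := fun r => by simp only [hD]; positivity
  have hprod : ∀ (b : ℕ → ℝ) (s : Finset ℕ) (r : ℝ), 0 < r →
      ‖(1 + Complex.I) * (α + 1 + r * (1 + Complex.I)) * raySum l b s α r‖ ≤
        D r * √(expEnergy (fun k => l k + 3 / 2) (fun k => b k / (l k + 1)) s) := by
    intro b s r hr
    have h1 : ‖(α : ℂ) + 1 + r * (1 + Complex.I)‖ ≤ α + 1 + r * 2 := by
      refine (norm_add_le _ _).trans (add_le_add ?_ ?_)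
      · rw [show (α : ℂ) + 1 = ((α + 1 : ℝ) : ℂ) by push_cast; ring, Complex.norm_real,
          Real.norm_of_nonneg (by positivity)]
      · rw [norm_mul, Complex.norm_real, Real.norm_of_nonneg hr.le]
        gcongr
        exact norm_one_add_I_le
    rw [norm_mul, norm_mul]
    calc _ ≤ (2 * (α + 1 + r * 2)) * (C * Real.exp (δ / 4 * r) *
          √(expEnergy (fun k => l k + 3 / 2) (fun k => b k / (l k + 1)) s)) := by
          gcongr
          · exact norm_one_add_I_le
          · exact hS b s r hr.le
      _ ≤ (K * Real.exp (δ / 4 * r)) * (C * Real.exp (δ / 4 * r) *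
          √(expEnergy (fun k => l k + 3 / 2) (fun k => b k / (l k + 1)) s)) := by
          refine mul_le_mul_of_nonneg_right (le_trans (le_of_eq ?_) (hKb r hr.le)) (by positivity)
          ring
      _ = _ := by
        simp only [hD]
        rw [show δ / 2 * r = δ / 4 * r + δ / 4 * r by ring, Real.exp_add]
        ring
  have hbd : ∀ x ∈ Set.Icc 0 ρ, ∀ r, 0 < r → ‖rayPow α x r‖ ≤ Real.exp (-δ * r) := by
    intro x hx r hr
    simpa [hδ] using norm_rayPow_le hα hr.le hx hρ hρ1
  have hDexp : ∀ r, D r * Real.exp (-δ * r) = K * C * Real.exp (-(δ / 2) * r) := fun r => by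
    simp only [hD]
    rw [mul_assoc, ← Real.exp_add]
    congr 2; ring
  have hdom : IntegrableOn (fun r => 2 * (K * C * Real.exp (-(δ / 2) * r))) (Set.Ioi 0) :=
    ((integrableOn_exp_neg_mul (by positivity)).const_mul _).const_mul _
  have hdiff : ∀ x ∈ Set.Icc 0 ρ, ∀ y ∈ Set.Icc 0 ρ, ∀ r, 0 < r →
      ‖D r * ‖rayPow α x r - rayPow α y r‖‖ ≤ 2 * (K * C * Real.exp (-(δ / 2) * r)) := by
    intro x hx y hy r hr
    rw [Real.norm_of_nonneg (mul_nonneg (hD0 r) (norm_nonneg _)), ← hDexp]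
    calc _ ≤ D r * (Real.exp (-δ * r) + Real.exp (-δ * r)) := by
          refine mul_le_mul_of_nonneg_left ?_ (hD0 r)
          exact (norm_sub_le _ _).trans (add_le_add (hbd x hx r hr) (hbd y hy r hr))
      _ = _ := by ring
  have hmeas : ∀ x y : ℝ, AEStronglyMeasurable (fun r => D r * ‖rayPow α x r - rayPow α y r‖)
      (volume.restrict (Set.Ioi 0)) := fun x y =>
    (hDc.measurable.mul ((measurable_rayPow α x).sub (measurable_rayPow α y)).norm
      ).aestronglyMeasurable
  have hae : ∀ {p : ℝ → Prop}, (∀ r, 0 < r → p r) → ∀ᵐ r ∂(volume.restrict (Set.Ioi (0:ℝ))), p r :=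
    fun h => (ae_restrict_mem measurableSet_Ioi).mono fun r hr => h r hr
  have hint : ∀ x ∈ Set.Icc 0 ρ, ∀ y ∈ Set.Icc 0 ρ,
      IntegrableOn (fun r => D r * ‖rayPow α x r - rayPow α y r‖) (Set.Ioi 0) :=
    fun x hx y hy => hdom.mono' (hmeas x y) (hae (hdiff x hx y hy))
  -- The coefficients enter only through the energy, so W depends on neither `b` nor `s`; W x y → 0
  -- by dominated convergence.
  refine ⟨fun x y => |rayConst|⁻¹ * ∫ r in Set.Ioi (0 : ℝ), D r * ‖rayPow α x r - rayPow α y r‖,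
    |rayConst|⁻¹ * ∫ r in Set.Ioi (0 : ℝ), 2 * (K * C * Real.exp (-(δ / 2) * r)), ?_, ?_, ?_⟩
  · intro x hx y hy
    refine mul_le_mul_of_nonneg_left ?_ (by positivity)
    exact integral_mono_ae (hint x hx y hy) hdom
      (hae fun r hr => (le_abs_self _).trans (hdiff x hx y hy r hr))
  · intro x hx
    suffices h0 : Filter.Tendsto
        (fun y => ∫ r in Set.Ioi (0 : ℝ), D r * ‖rayPow α x r - rayPow α y r‖)
        (nhdsWithin x (Set.Icc 0 ρ)) (nhds (∫ r in Set.Ioi (0 : ℝ), (0 : ℝ))) by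
      simpa using h0.const_mul |rayConst|⁻¹
    refine tendsto_integral_filter_of_dominated_convergence _
      (Filter.Eventually.of_forall fun y => hmeas x y) ?_ hdom (hae fun r hr => ?_)
    · filter_upwards [self_mem_nhdsWithin] with y hy
      exact hae (hdiff x hx y hy)
    · have h1 : Continuous fun y => D r * ‖rayPow α x r - rayPow α y r‖ := by
        have := continuous_rayPow (r := r) hα hr.le
        fun_prop
      have h2 := (h1.tendsto x).mono_left (nhdsWithin_le_nhds (s := Set.Icc 0 ρ))
      simpa using h2
  · intro b s x hx y hy
    set E := √(expEnergy (fun k => l k + 3 / 2) (fun k => b k / (l k + 1)) s)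
    have hI : ∀ z ∈ Set.Icc 0 ρ, IntegrableOn (rayIntegrand l b s α z) (Set.Ioi 0) := by
      intro z hz
      refine (hdom.mul_const E).mono' ?_ (hae fun r hr => ?_)
      · refine Measurable.aestronglyMeasurable ?_
        have := measurable_rayPow α z
        unfold rayIntegrand raySum
        fun_prop
      · have h1 : rayIntegrand l b s α z r = ((1 + Complex.I) * (α + 1 + r * (1 + Complex.I)) *
          raySum l b s α r) * rayPow α z r := by unfold rayIntegrand; ring
        rw [h1, norm_mul, ← hDexp]
        calc _ ≤ (D r * E) * Real.exp (-δ * r) := by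
              refine mul_le_mul (hprod b s r hr) (hbd z hz r hr) (norm_nonneg _) ?_
              exact mul_nonneg (hD0 r) (Real.sqrt_nonneg _)
          _ ≤ _ := by
            have : 0 ≤ D r * Real.exp (-δ * r) * E :=
              mul_nonneg (mul_nonneg (hD0 r) (Real.exp_pos _).le) (Real.sqrt_nonneg _)
            linarith
    have h1 := integral_rayIntegrand_im l b hl hα hne s hx.1 (hx.2.trans_lt hρ1)
    have h2 := integral_rayIntegrand_im l b hl hα hne s hy.1 (hy.2.trans_lt hρ1)
    have h3 : rayConst * (∑ k ∈ s with α < l k, b k * x ^ l k -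
        ∑ k ∈ s with α < l k, b k * y ^ l k)
        = (∫ r in Set.Ioi (0 : ℝ), (rayIntegrand l b s α x r - rayIntegrand l b s α y r)).im := by
      rw [integral_sub (hI x hx) (hI y hy), Complex.sub_im, h1, h2]
      ring
    have h4 : |rayConst| * |∑ k ∈ s with α < l k, b k * x ^ l k -
        ∑ k ∈ s with α < l k, b k * y ^ l k|
        ≤ (∫ r in Set.Ioi (0 : ℝ), D r * ‖rayPow α x r - rayPow α y r‖) * E := by
      rw [← abs_mul, h3, ← integral_mul_const]
      refine (Complex.abs_im_le_norm _).trans ((norm_integral_le_integral_norm _).trans ?_)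
      refine integral_mono_ae ((hI x hx).sub (hI y hy)).norm ((hint x hx y hy).mul_const E)
        (hae fun r hr => ?_)
      have h5 : rayIntegrand l b s α x r - rayIntegrand l b s α y r =
          ((1 + Complex.I) * (α + 1 + r * (1 + Complex.I)) * raySum l b s α r) *
            (rayPow α x r - rayPow α y r) := by unfold rayIntegrand; ring
      simp only [h5]
      rw [norm_mul]
      calc _ ≤ (D r * E) * ‖rayPow α x r - rayPow α y r‖ := by
            gcongr
            exact hprod b s r hr
        _ = _ := by ring
    have h6 : 0 < |rayConst| := abs_pos.2 rayConst_ne_zero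
    rw [mul_assoc]
    rwa [le_inv_mul_iff₀ h6]

/-! ### From the energy to the L¹ norm -/

lemma continuous_muntz_sum (l b : ℕ → ℝ) (hl : ∀ k, 0 ≤ l k) (s : Finset ℕ) :
    Continuous fun x : ℝ => ∑ k ∈ s, b k * x ^ l k :=
  continuous_finsetSum _ fun k _ => continuous_const.mul (Real.continuous_rpow_const (hl k))

lemma integral_muntz_sum (l b : ℕ → ℝ) (hl : ∀ k, 0 ≤ l k) (s : Finset ℕ) (x : ℝ) :
    ∫ t in (0 : ℝ)..x, ∑ k ∈ s, b k * t ^ l k = ∑ k ∈ s, b k / (l k + 1) * x ^ (l k + 1) := by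
  have hc : ∀ k ∈ s, IntervalIntegrable (fun t : ℝ => b k * t ^ l k) volume 0 x := fun k _ =>
    (continuous_const.mul (Real.continuous_rpow_const (hl k))).intervalIntegrable _ _
  rw [intervalIntegral.integral_finsetSum hc]
  refine Finset.sum_congr rfl fun k _ => ?_
  have hk := hl k
  rw [intervalIntegral.integral_const_mul, integral_rpow (Or.inl (by linarith)),
    Real.zero_rpow (by positivity)]
  ring

/-- The integral of x^{(l_j+1)+(l_k+1)} is 1/((l_j + 3/2) + (l_k + 3/2)); this is the origin of the
shift 3/2. -/
lemma expEnergy_eq_integral (l c : ℕ → ℝ) (hl : ∀ k, 0 ≤ l k) (s : Finset ℕ) :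
    expEnergy (fun k => l k + 3 / 2) c s
      = ∫ x in (0 : ℝ)..1, (∑ k ∈ s, c k * x ^ (l k + 1)) ^ 2 := by
  have h1 : ∀ j k, 0 ≤ (l j + 1) + (l k + 1) := fun j k => by
    have := hl j; have := hl k; positivity
  have h2 : ∫ x in (0 : ℝ)..1, (∑ k ∈ s, c k * x ^ (l k + 1)) ^ 2
      = ∫ x in (0 : ℝ)..1, ∑ j ∈ s, ∑ k ∈ s, c j * c k * x ^ ((l j + 1) + (l k + 1)) := by
    refine intervalIntegral.integral_congr fun x hx => ?_
    rw [Set.uIcc_of_le zero_le_one] at hx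
    simp only [sq, Finset.sum_mul_sum]
    refine Finset.sum_congr rfl fun j _ => Finset.sum_congr rfl fun k _ => ?_
    rw [Real.rpow_add_of_nonneg (y := l j + 1) (z := l k + 1) hx.1
      (by have := hl j; positivity) (by have := hl k; positivity)]
    exact mul_mul_mul_comm (c j) (x ^ (l j + 1)) (c k) (x ^ (l k + 1))
  have hc : ∀ j k, Continuous fun x : ℝ => c j * c k * x ^ ((l j + 1) + (l k + 1)) := fun j k =>
    continuous_const.mul (Real.continuous_rpow_const (h1 j k))
  rw [h2, intervalIntegral.integral_finsetSum fun j _ =>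
    (continuous_finsetSum _ fun k _ => hc j k).intervalIntegrable _ _]
  refine Finset.sum_congr rfl fun j _ => ?_
  rw [intervalIntegral.integral_finsetSum fun k _ => (hc j k).intervalIntegrable _ _]
  refine Finset.sum_congr rfl fun k _ => ?_
  have h3 := h1 j k
  rw [intervalIntegral.integral_const_mul, integral_rpow (Or.inl (by linarith)), Real.one_rpow,
    Real.zero_rpow (by positivity)]
  simp only
  rw [show l j + 1 + (l k + 1) + 1 = l j + 3 / 2 + (l k + 3 / 2) by ring]
  ring

/-- The antiderivative vanishing at 0 is bounded on [0,1] by the L¹ norm, hence so is its L² norm.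
-/
lemma expEnergy_le_sq (l b : ℕ → ℝ) (hl : ∀ k, 0 ≤ l k) (s : Finset ℕ) :
    expEnergy (fun k => l k + 3 / 2) (fun k => b k / (l k + 1)) s
      ≤ (∫ t in (0 : ℝ)..1, |∑ k ∈ s, b k * t ^ l k|) ^ 2 := by
  set N := ∫ t in (0 : ℝ)..1, |∑ k ∈ s, b k * t ^ l k|
  have hc := continuous_muntz_sum l b hl s
  have hF : ∀ x ∈ Set.Icc (0 : ℝ) 1,
      (∑ k ∈ s, b k / (l k + 1) * x ^ (l k + 1)) ^ 2 ≤ N ^ 2 := by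
    intro x hx
    rw [← integral_muntz_sum l b hl, ← sq_abs]
    refine pow_le_pow_left₀ (abs_nonneg _) ?_ 2
    refine (intervalIntegral.abs_integral_le_integral_abs hx.1).trans ?_
    exact intervalIntegral.integral_mono_interval le_rfl hx.1 hx.2
      (Filter.Eventually.of_forall fun _ => abs_nonneg _) (hc.abs.intervalIntegrable _ _)
  rw [expEnergy_eq_integral _ _ hl]
  have hc2 : Continuous fun x : ℝ => (∑ k ∈ s, b k / (l k + 1) * x ^ (l k + 1)) ^ 2 :=
    (continuous_muntz_sum (fun k => l k + 1) (fun k => b k / (l k + 1))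
      (fun k => by have := hl k; positivity) s).pow 2
  calc _ ≤ ∫ x in (0 : ℝ)..1, N ^ 2 :=
        intervalIntegral.integral_mono_on zero_le_one (hc2.intervalIntegrable _ _)
          (continuous_const.intervalIntegrable _ _) hF
    _ = N ^ 2 := by simp

/-- Real Müntz polynomials with bounded `L¹` norm are bounded and equicontinuous on `[0, ρ]`. -/
theorem exists_modulus_real (l : ℕ → ℝ) (hl : ∀ k, 0 ≤ l k) (hmono : StrictMono l)
    (hsum : Summable fun k => (l k)⁻¹) (htop : Filter.Tendsto l Filter.atTop Filter.atTop)
    {ρ : ℝ} (hρ : 0 < ρ) (hρ1 : ρ < 1) :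
    ∃ (V : ℝ → ℝ → ℝ) (B : ℝ), 0 ≤ B ∧
      (∀ x ∈ Set.Icc 0 ρ, Filter.Tendsto (V x) (nhdsWithin x (Set.Icc 0 ρ)) (nhds 0)) ∧
      ∀ (b : ℕ → ℝ) (s : Finset ℕ), ∀ x ∈ Set.Icc 0 ρ,
        |∑ k ∈ s, b k * x ^ l k| ≤ B * (∫ t in (0 : ℝ)..1, |∑ k ∈ s, b k * t ^ l k|) ∧
        ∀ y ∈ Set.Icc 0 ρ,
        |∑ k ∈ s, b k * x ^ l k - ∑ k ∈ s, b k * y ^ l k| ≤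
          V x y * (∫ t in (0 : ℝ)..1, |∑ k ∈ s, b k * t ^ l k|) := by
  -- Only the exponent l 0 lies below α, and α > 0 even if l 0 = 0.
  set α := (l 0 + l 1) / 2 with hαd
  have h01 : l 0 < l 1 := hmono zero_lt_one
  have hα : 0 < α := by have := hl 0; rw [hαd]; linarith
  have hlt : ∀ k, α < l k ↔ k ≠ 0 := fun k => by
    constructor
    · rintro h rfl
      rw [hαd] at h; linarith
    · intro h
      have : l 1 ≤ l k := hmono.monotone (Nat.one_le_iff_ne_zero.2 h)
      rw [hαd]; linarith
  have hne : ∀ k, l k ≠ α := fun k h => by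
    rcases eq_or_ne k 0 with rfl | hk
    · rw [hαd] at h; linarith
    · exact ((hlt k).2 hk).ne' h
  obtain ⟨W, B, hWB, hWt, hW⟩ := exists_modulus l hl hα hne hsum htop hρ hρ1
  set c : ℝ := (l 0 + 1) / ρ ^ (l 0 + 1) * (1 + |B|) with hc
  have hl0 := hl 0
  have hc0 : 0 ≤ c := by positivity
  have h0ρ : (0 : ℝ) ∈ Set.Icc 0 ρ := ⟨le_rfl, hρ.le⟩
  have hρl0 : ∀ x ∈ Set.Icc 0 ρ, |x ^ l 0| ≤ 1 := fun x hx => by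
    rw [abs_of_nonneg (Real.rpow_nonneg hx.1 _)]
    exact Real.rpow_le_one hx.1 (hx.2.trans hρ1.le) hl0
  have main : ∀ (b : ℕ → ℝ) (s : Finset ℕ), ∃ β : ℝ,
      |β| ≤ c * (∫ t in (0 : ℝ)..1, |∑ k ∈ s, b k * t ^ l k|) ∧
      (∀ x, ∑ k ∈ s, b k * x ^ l k = β * x ^ l 0 + ∑ k ∈ s with α < l k, b k * x ^ l k) ∧
      (∀ x ∈ Set.Icc 0 ρ, |∑ k ∈ s with α < l k, b k * x ^ l k| ≤
        |B| * (∫ t in (0 : ℝ)..1, |∑ k ∈ s, b k * t ^ l k|)) ∧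
      ∀ x ∈ Set.Icc 0 ρ, ∀ y ∈ Set.Icc 0 ρ,
        |∑ k ∈ s with α < l k, b k * x ^ l k - ∑ k ∈ s with α < l k, b k * y ^ l k| ≤
          |W x y| * (∫ t in (0 : ℝ)..1, |∑ k ∈ s, b k * t ^ l k|) := by
    intro b s
    set N := ∫ t in (0 : ℝ)..1, |∑ k ∈ s, b k * t ^ l k|
    have hN : 0 ≤ N := intervalIntegral.integral_nonneg zero_le_one fun _ _ => abs_nonneg _
    have hE : √(expEnergy (fun k => l k + 3 / 2) (fun k => b k / (l k + 1)) s) ≤ N :=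
      Real.sqrt_le_iff.2 ⟨hN, expEnergy_le_sq l b hl s⟩
    set p : ℝ → ℝ := fun x => ∑ k ∈ s, b k * x ^ l k with hp
    set h : ℝ → ℝ := fun x => ∑ k ∈ s with α < l k, b k * x ^ l k with hh
    set β : ℝ := if 0 ∈ s then b 0 else 0 with hβ
    have hdec : ∀ x, p x = β * x ^ l 0 + h x := fun x => by
      simp only [hp, hh, hlt]
      rw [← Finset.sum_filter_add_sum_filter_not s (fun k => k = 0), Finset.filter_eq' s 0]
      congr 1
      rw [hβ]
      split_ifs <;> simp
    have hW' : ∀ x ∈ Set.Icc 0 ρ, ∀ y ∈ Set.Icc 0 ρ, |h x - h y| ≤ |W x y| * N :=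
      fun x hx y hy => (hW b s x hx y hy).trans
        (mul_le_mul (le_abs_self _) hE (Real.sqrt_nonneg _) (abs_nonneg _))
    have hh0 : h 0 = 0 := Finset.sum_eq_zero fun k hk => by
      rw [Real.zero_rpow (hα.trans (Finset.mem_filter.1 hk).2).ne', mul_zero]
    have hhB : ∀ x ∈ Set.Icc 0 ρ, |h x| ≤ |B| * N := fun x hx => by
      have h1 := hW b s x hx 0 h0ρ
      change |h x - h 0| ≤ _ at h1
      rw [hh0, sub_zero] at h1
      refine h1.trans (mul_le_mul ((hWB x hx 0 h0ρ).trans (le_abs_self _)) hE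
        (Real.sqrt_nonneg _) (abs_nonneg _))
    refine ⟨β, ?_, hdec, hhB, hW'⟩
    have hpc : Continuous p := continuous_muntz_sum l b hl s
    have hxc : Continuous fun x : ℝ => |β| * x ^ l 0 :=
      continuous_const.mul (Real.continuous_rpow_const hl0)
    -- The remaining coefficient is controlled by integrating |β| x^{l 0} = |p - h| over [0, ρ].
    have h1 : ∫ x in (0 : ℝ)..ρ, |β| * x ^ l 0 ≤ ∫ x in (0 : ℝ)..ρ, (|p x| + |B| * N) := by
      refine intervalIntegral.integral_mono_on hρ.le (hxc.intervalIntegrable _ _)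
        ((hpc.abs.add continuous_const).intervalIntegrable _ _) fun x hx => ?_
      have h2 : |β| * x ^ l 0 = |p x - h x| := by
        rw [hdec, add_sub_cancel_right, abs_mul, abs_of_nonneg (Real.rpow_nonneg hx.1 _)]
      rw [h2]
      exact (abs_sub _ _).trans (add_le_add le_rfl (hhB x hx))
    have h3 : ∫ x in (0 : ℝ)..ρ, (|p x| + |B| * N) ≤ (1 + |B|) * N := by
      rw [intervalIntegral.integral_add (hpc.abs.intervalIntegrable _ _)
        (continuous_const.intervalIntegrable _ _), intervalIntegral.integral_const, add_mul, one_mul,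
        sub_zero, smul_eq_mul]
      refine add_le_add ?_ (mul_le_of_le_one_left (by positivity) hρ1.le)
      exact intervalIntegral.integral_mono_interval le_rfl hρ.le hρ1.le
        (Filter.Eventually.of_forall fun _ => abs_nonneg _) (hpc.abs.intervalIntegrable _ _)
    rw [intervalIntegral.integral_const_mul, integral_rpow (Or.inl (by linarith)),
      Real.zero_rpow (by positivity), sub_zero] at h1
    have h4 : 0 < ρ ^ (l 0 + 1) := Real.rpow_pos_of_pos hρ _
    calc |β| = (l 0 + 1) / ρ ^ (l 0 + 1) * (|β| * (ρ ^ (l 0 + 1) / (l 0 + 1))) := by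
          field_simp
      _ ≤ (l 0 + 1) / ρ ^ (l 0 + 1) * ((1 + |B|) * N) := by
          exact mul_le_mul_of_nonneg_left (h1.trans h3) (by positivity)
      _ = c * N := by rw [hc]; ring
  refine ⟨fun x y => c * |x ^ l 0 - y ^ l 0| + |W x y|, c + |B|, by positivity, ?_, ?_⟩
  · intro x hx
    have h1 : Continuous fun y : ℝ => c * |x ^ l 0 - y ^ l 0| := by
      have := Real.continuous_rpow_const hl0
      fun_prop
    have h2 := (h1.tendsto x).mono_left (nhdsWithin_le_nhds (s := Set.Icc 0 ρ))
    have h3 := h2.add (hWt x hx).abs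
    simpa using h3
  · intro b s x hx
    obtain ⟨β, hβ, hdec, hhB, hW'⟩ := main b s
    set N := ∫ t in (0 : ℝ)..1, |∑ k ∈ s, b k * t ^ l k|
    refine ⟨?_, fun y hy => ?_⟩
    · rw [hdec, add_mul]
      refine (abs_add_le _ _).trans (add_le_add ?_ (hhB x hx))
      rw [abs_mul]
      exact (mul_le_of_le_one_right (abs_nonneg _) (hρl0 x hx)).trans hβ
    · rw [hdec x, hdec y, add_sub_add_comm, ← mul_sub, add_mul]
      refine (abs_add_le _ _).trans (add_le_add ?_ (hW' x hx y hy))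
      rw [abs_mul, mul_right_comm]
      gcongr

/-! ### Passage to real or complex Müntz polynomials on the unit interval -/

variable {𝕜 : Type*} [RCLike 𝕜]

lemma exists_coeff_of_mem_polySpace {Λ : ℕ → ℝ≥0} {p : C(I, 𝕜)} (hp : p ∈ polySpace 𝕜 Λ) :
    ∃ (s : Finset ℕ) (a : ℕ → 𝕜), ∀ x : I,
      p x = ∑ k ∈ s, a k * (((x : ℝ) ^ (Λ k : ℝ) : ℝ) : 𝕜) := by
  obtain ⟨a, rfl⟩ := Finsupp.mem_span_range_iff_exists_finsupp.1 hp
  refine ⟨a.support, a, fun x => ?_⟩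
  rw [Finsupp.sum, ContinuousMap.sum_apply]
  rfl

lemma integral_unitInterval {E : Type*} [NormedAddCommGroup E] [NormedSpace ℝ E] (f : ℝ → E) :
    ∫ t : I, f t = ∫ t in (0 : ℝ)..1, f t := by
  rw [intervalIntegral.integral_of_le zero_le_one, ← integral_Icc_eq_integral_Ioc]
  exact integral_subtype measurableSet_Icc f

lemma integrable_unitInterval {E : Type*} [NormedAddCommGroup E] (f : C(I, E)) :
    Integrable f :=
  f.continuous.integrable_of_hasCompactSupport (HasCompactSupport.of_compactSpace _)

lemma norm_le_abs_re_add_abs_im (z : 𝕜) : ‖z‖ ≤ |RCLike.re z| + |RCLike.im z| := by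
  refine abs_le_of_sq_le_sq' ?_ (by positivity) |>.2
  rw [← RCLike.normSq_eq_def', RCLike.normSq_apply, ← abs_mul_abs_self (RCLike.re z),
    ← abs_mul_abs_self (RCLike.im z)]
  nlinarith [mul_nonneg (abs_nonneg (RCLike.re z)) (abs_nonneg (RCLike.im z))]

/-- The Müntz polynomials with bounded `L¹` norm are bounded and equicontinuous on `[0, ρ]`. -/
theorem exists_modulus_polySpace (Λ : ℕ → ℝ≥0) (hΛ : StrictMono Λ)
    (hMuntz : Summable fun k => (Λ k)⁻¹) {ρ : ℝ} (hρ : 0 < ρ) (hρ1 : ρ < 1) :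
    ∃ (V : ℝ → ℝ → ℝ) (B : ℝ), 0 ≤ B ∧
      (∀ x ∈ Set.Icc 0 ρ, Filter.Tendsto (V x) (nhdsWithin x (Set.Icc 0 ρ)) (nhds 0)) ∧
      ∀ p ∈ polySpace 𝕜 Λ, ∀ x : I, (x : ℝ) ≤ ρ → ‖p x‖ ≤ B * (∫ t : I, ‖p t‖) ∧
        ∀ y : I, (y : ℝ) ≤ ρ → ‖p x - p y‖ ≤ V x y * (∫ t : I, ‖p t‖) := by
  have hsum : Summable fun k => ((Λ k : ℝ))⁻¹ := by
    simpa using (NNReal.summable_coe.2 hMuntz)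
  have hmono : StrictMono fun k => (Λ k : ℝ) := fun _ _ h => NNReal.coe_lt_coe.2 (hΛ h)
  have htop : Filter.Tendsto (fun k => (Λ k : ℝ)) Filter.atTop Filter.atTop := by
    have h1 := hsum.tendsto_atTop_zero
    have h2 : Filter.Tendsto (fun k => ((Λ k : ℝ))⁻¹) Filter.atTop (nhdsWithin 0 (Set.Ioi 0)) := by
      refine tendsto_nhdsWithin_iff.2 ⟨h1, ?_⟩
      -- Index 0 is excluded because λ_0 may be 0, with inverse 0.
      filter_upwards [Filter.eventually_ge_atTop 1] with k hk
      have : (0 : ℝ) < Λ k := lt_of_le_of_lt (Λ 0).coe_nonneg (hmono (by omega))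
      exact inv_pos.2 this
    exact h2.inv_tendsto_nhdsGT_zero.congr fun k => inv_inv _
  obtain ⟨V, B, hB, hV, h⟩ := exists_modulus_real (fun k => (Λ k : ℝ)) (fun k => (Λ k).coe_nonneg)
    hmono hsum htop hρ hρ1
  refine ⟨fun x y => 2 * |V x y|, 2 * B, by positivity, fun x hx => by
    simpa using (hV x hx).abs.const_mul 2, fun p hp x hx => ?_⟩
  obtain ⟨s, a, ha⟩ := exists_coeff_of_mem_polySpace hp
  set N := ∫ t : I, ‖p t‖
  have hN : 0 ≤ N := integral_nonneg fun _ => norm_nonneg _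
  have hx' : (x : ℝ) ∈ Set.Icc 0 ρ := ⟨x.2.1, hx⟩
  have part : ∀ (φ : 𝕜 → ℝ) (b : ℕ → ℝ), (∀ z, |φ z| ≤ ‖z‖) →
      (∀ x : I, φ (p x) = ∑ k ∈ s, b k * (x : ℝ) ^ (Λ k : ℝ)) →
      |φ (p x)| ≤ B * N ∧ ∀ y : I, (y : ℝ) ≤ ρ → |φ (p x) - φ (p y)| ≤ |V x y| * N := by
    intro φ b hφ hb
    have hN' : ∫ t in (0 : ℝ)..1, |∑ k ∈ s, b k * t ^ (Λ k : ℝ)| ≤ N := by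
      rw [← integral_unitInterval]
      refine integral_mono ?_ (integrable_unitInterval p).norm fun t => ?_
      · have hc : Continuous fun t : I => |∑ k ∈ s, b k * (t : ℝ) ^ (Λ k : ℝ)| :=
          ((continuous_muntz_sum (fun k => (Λ k : ℝ)) b (fun k => (Λ k).coe_nonneg) s).comp
            continuous_subtype_val).abs
        exact integrable_unitInterval ⟨_, hc⟩
      · simp only [← hb]
        exact hφ _
    have hN0 : 0 ≤ ∫ t in (0 : ℝ)..1, |∑ k ∈ s, b k * t ^ (Λ k : ℝ)| :=
      intervalIntegral.integral_nonneg zero_le_one fun _ _ => abs_nonneg _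
    obtain ⟨h1, h2⟩ := h b s x hx'
    refine ⟨?_, fun y hy => ?_⟩
    · rw [hb]
      exact h1.trans (by gcongr)
    · rw [hb, hb]
      exact (h2 y ⟨y.2.1, hy⟩).trans (mul_le_mul (le_abs_self _) hN' hN0 (abs_nonneg _))
  obtain ⟨hre, hre'⟩ := part RCLike.re (fun k => RCLike.re (a k)) RCLike.abs_re_le_norm
    fun x => by rw [ha, map_sum]; simp
  obtain ⟨him, him'⟩ := part RCLike.im (fun k => RCLike.im (a k)) RCLike.abs_im_le_norm
    fun x => by rw [ha, map_sum]; simp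
  refine ⟨?_, fun y hy => ?_⟩
  · have := norm_le_abs_re_add_abs_im (p x)
    linarith
  · have h1 := norm_le_abs_re_add_abs_im (p x - p y)
    rw [map_sub, map_sub] at h1
    have h2 := hre' y hy
    have h3 := him' y hy
    linarith

/-! ### Dilation and averaging operators -/

/-- The dilation `p ↦ p (r ·)` of `C([0,1])`. -/
noncomputable def dilation (r : I) : C(I, 𝕜) →L[𝕜] C(I, 𝕜) :=
  LinearMap.mkContinuous
    { toFun := fun p => p.comp ⟨fun x : I => r * x, by fun_prop⟩
      map_add' := fun _ _ => rfl
      map_smul' := fun _ _ => rfl } 1 fun p => by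
    rw [one_mul, ContinuousMap.norm_le _ (norm_nonneg _)]
    exact fun x => p.norm_coe_le_norm _

@[simp] lemma dilation_apply (r : I) (p : C(I, 𝕜)) (x : I) : dilation r p x = p (r * x) := rfl

lemma dilation_mem_polySpace {Λ : ℕ → ℝ≥0} (r : I) {p : C(I, 𝕜)} (hp : p ∈ polySpace 𝕜 Λ) :
    dilation r p ∈ polySpace 𝕜 Λ := by
  have h : polySpace 𝕜 Λ ≤ (polySpace 𝕜 Λ).comap (dilation r).toLinearMap := by
    refine Submodule.span_le.2 ?_
    rintro _ ⟨k, rfl⟩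
    have : dilation r (monomial 𝕜 (Λ k)) = (((r : ℝ) ^ (Λ k : ℝ) : ℝ) : 𝕜) • monomial 𝕜 (Λ k) := by
      ext x
      simp [monomial, Real.mul_rpow r.2.1 x.2.1]
    change dilation r (monomial 𝕜 (Λ k)) ∈ polySpace 𝕜 Λ
    rw [this]
    exact Submodule.smul_mem _ _ (Submodule.subset_span ⟨k, rfl⟩)
  exact h hp

lemma continuous_average (p : C(I, 𝕜)) : Continuous fun x : I => ∫ t : I, p (t * x) :=
  (continuous_parametric_integral_of_continuous (μ := (volume : Measure I))
    (f := fun x t : I => p (t * x)) (by unfold Function.uncurry; fun_prop)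
    isCompact_univ).congr fun x => by rw [Measure.restrict_univ]

lemma norm_integral_unitInterval_le {f : I → 𝕜} {C : ℝ} (h : ∀ t, ‖f t‖ ≤ C) :
    ‖∫ t : I, f t‖ ≤ C := by
  simpa using norm_integral_le_of_norm_le_const (μ := (volume : Measure I))
    (Filter.Eventually.of_forall h)

/-- The averaging operator `p ↦ ∫_0^1 p (t ·) dt`, which is `(1/x) ∫_0^x p` for `x > 0`. -/
noncomputable def average : C(I, 𝕜) →L[𝕜] C(I, 𝕜) :=
  LinearMap.mkContinuous
    { toFun := fun p => ⟨fun x => ∫ t : I, p (t * x), continuous_average p⟩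
      map_add' := fun p p' => by
        ext x
        exact integral_add (integrable_unitInterval (p.comp ⟨fun t : I => t * x, by fun_prop⟩))
          (integrable_unitInterval (p'.comp ⟨fun t : I => t * x, by fun_prop⟩))
      map_smul' := fun c p => by
        ext x
        exact integral_const_mul c _ } 1 fun p => by
    rw [one_mul, ContinuousMap.norm_le _ (norm_nonneg _)]
    exact fun x => norm_integral_unitInterval_le fun t => p.norm_coe_le_norm _

lemma average_apply (p : C(I, 𝕜)) (x : I) : average p x = ∫ t : I, p (t * x) := rfl

lemma average_mem_polySpace {Λ : ℕ → ℝ≥0} {p : C(I, 𝕜)} (hp : p ∈ polySpace 𝕜 Λ) :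
    average p ∈ polySpace 𝕜 Λ := by
  have h : polySpace 𝕜 Λ ≤ (polySpace 𝕜 Λ).comap (average (𝕜 := 𝕜)).toLinearMap := by
    refine Submodule.span_le.2 ?_
    rintro _ ⟨k, rfl⟩
    have : average (monomial 𝕜 (Λ k))
        = (∫ t : I, (((t : ℝ) ^ (Λ k : ℝ) : ℝ) : 𝕜)) • monomial 𝕜 (Λ k) := by
      ext x
      rw [average_apply, ContinuousMap.smul_apply, smul_eq_mul, ← integral_mul_const]
      refine integral_congr_ae (Filter.Eventually.of_forall fun t => ?_)
      simp [monomial, Real.mul_rpow t.2.1 x.2.1]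
    change average (monomial 𝕜 (Λ k)) ∈ polySpace 𝕜 Λ
    rw [this]
    exact Submodule.smul_mem _ _ (Submodule.subset_span ⟨k, rfl⟩)
  exact h hp

lemma average_zero (p : C(I, 𝕜)) : average p 0 = p 0 := by
  simp [average_apply]

/-- The extension of a function on `[0,1]` to `ℝ` by its end values. -/
noncomputable def extendReal (p : C(I, 𝕜)) : ℝ → 𝕜 := fun t => p (Set.projIcc 0 1 zero_le_one t)

lemma continuous_extendReal (p : C(I, 𝕜)) : Continuous (extendReal p) :=
  p.continuous.comp continuous_projIcc

@[simp] lemma extendReal_coe (p : C(I, 𝕜)) (t : I) : extendReal p t = p t := by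
  simp [extendReal]

lemma setIntegral_unitInterval {E : Type*} [NormedAddCommGroup E] [NormedSpace ℝ E] (f : ℝ → E)
    {a b : I} (hab : a ≤ b) : ∫ t in Set.Icc a b, f t = ∫ t in (a : ℝ)..b, f t := by
  have h := (measurePreserving_subtype_coe (μa := (volume : Measure ℝ))
    (measurableSet_Icc (a := (0 : ℝ)) (b := 1))).setIntegral_preimage_emb
      (MeasurableEmbedding.subtype_coe measurableSet_Icc) f (Set.Icc (a : ℝ) b)
  have h2 : (Subtype.val ⁻¹' Set.Icc (a : ℝ) b : Set I) = Set.Icc a b := rfl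
  rw [intervalIntegral.integral_of_le hab, ← integral_Icc_eq_integral_Ioc]
  rw [Measure.restrict_restrict measurableSet_Icc, Set.inter_eq_self_of_subset_left
    (Set.Icc_subset_Icc a.2.1 b.2.2)] at h
  exact h

lemma integral_norm_extendReal (p : C(I, 𝕜)) :
    ∫ t in (0 : ℝ)..1, ‖extendReal p t‖ = ∫ t : I, ‖p t‖ := by
  rw [← integral_unitInterval]
  simp

lemma average_eq_extendReal (p : C(I, 𝕜)) (x : I) :
    average p x = ∫ t in (0 : ℝ)..1, extendReal p (t * x) := by
  rw [← integral_unitInterval, average_apply]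
  refine integral_congr_ae (Filter.Eventually.of_forall fun t => ?_)
  exact (extendReal_coe p (t * x)).symm

/-- The substitution t ↦ rt turns the subtracted term into the part of the average over [0, r]. -/
lemma average_sub_dilation (p : C(I, 𝕜)) (r x : I) :
    average p x - ((r : ℝ) : 𝕜) * average (dilation r p) x
      = ∫ t in (r : ℝ)..1, extendReal p (t * x) := by
  have hc : Continuous fun t : ℝ => extendReal p (t * x) :=
    (continuous_extendReal p).comp (by fun_prop)
  have h1 : average (dilation r p) x = ∫ t in (0 : ℝ)..1, extendReal p (t * r * x) := by
    rw [average_eq_extendReal, ← integral_unitInterval, ← integral_unitInterval]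
    refine integral_congr_ae (Filter.Eventually.of_forall fun t => ?_)
    have h2 := extendReal_coe (dilation r p) (t * x)
    have h3 := extendReal_coe p (t * r * x)
    push_cast at h2 h3
    simp only
    rw [h2, h3, dilation_apply]
    congr 1
    ac_rfl
  have h4 := intervalIntegral.smul_integral_comp_mul_right (a := 0) (b := 1)
    (fun t : ℝ => extendReal p (t * x)) (r : ℝ)
  rw [zero_mul, one_mul] at h4
  rw [h1, average_eq_extendReal, ← RCLike.real_smul_eq_coe_mul, h4,
    intervalIntegral.integral_interval_sub_left (hc.intervalIntegrable _ _)
      (hc.intervalIntegrable _ _)]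

lemma integral_extendReal_mul (p : C(I, 𝕜)) (r x : I) :
    ((x : ℝ) : 𝕜) * ∫ t in (r : ℝ)..1, extendReal p (t * x)
      = ∫ t in (r * x : ℝ)..x, extendReal p t := by
  rw [← RCLike.real_smul_eq_coe_mul, intervalIntegral.smul_integral_comp_mul_right, one_mul]

lemma mul_average (p : C(I, 𝕜)) (x : I) :
    ((x : ℝ) : 𝕜) * average p x = ∫ t in Set.Icc 0 x, p t := by
  have h := integral_extendReal_mul p 0 x
  have h2 := setIntegral_unitInterval (extendReal p) (a := 0) (b := x) x.2.1
  simp only [extendReal_coe] at h2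
  rw [average_eq_extendReal, h2]
  simpa using h

lemma norm_intervalIntegral_extendReal_le (p : C(I, 𝕜)) {a b : ℝ} (ha : 0 ≤ a) (hab : a ≤ b)
    (hb : b ≤ 1) : ‖∫ t in a..b, extendReal p t‖ ≤ ∫ t : I, ‖p t‖ := by
  rw [← integral_norm_extendReal]
  refine (intervalIntegral.norm_integral_le_integral_norm hab).trans ?_
  exact intervalIntegral.integral_mono_interval ha hab hb
    (Filter.Eventually.of_forall fun _ => norm_nonneg _)
    ((continuous_extendReal p).norm.intervalIntegrable _ _)

lemma extendReal_of_mem (p : C(I, 𝕜)) {t : ℝ} (ht : t ∈ Set.Icc (0 : ℝ) 1) :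
    extendReal p t = p ⟨t, ht⟩ := extendReal_coe p ⟨t, ht⟩

/-! ### The halving estimate -/

/-- Subtracting half of the mass near `1` halves the norm. -/
lemma norm_integral_sub_half_le (p : C(I, 𝕜)) {ρ r x M : ℝ} (hρ : 0 ≤ ρ) (hr : 0 ≤ r) (hr1 : r ≤ 1)
    (hρx : ρ ≤ x) (hx : x ≤ 1) (hM : ∀ y : I, (y : ℝ) ≤ ρ → ‖p y‖ ≤ M) :
    ‖(∫ t in (r * x)..x, extendReal p t) - 1 / 2 * ∫ t in ρ..1, extendReal p t‖
      ≤ 1 / 2 * (∫ t : I, ‖p t‖) + (1 - r) * M := by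
  -- The interval [rx, c] lies in [0, ρ] and has length at most 1 - r, so M controls it; [c, x] lies
  -- in [ρ, 1].
  set c := max (r * x) ρ with hc
  have hx0 : 0 ≤ x := hρ.trans hρx
  have hrx : r * x ≤ x := mul_le_of_le_one_left hx0 hr1
  have hrx0 : 0 ≤ r * x := mul_nonneg hr hx0
  have hcx : c ≤ x := max_le hrx hρx
  have hρc : ρ ≤ c := le_max_right _ _
  have hrc : r * x ≤ c := le_max_left _ _
  have hM0 : 0 ≤ M := (norm_nonneg _).trans (hM 0 hρ)
  have hi : ∀ a b, IntervalIntegrable (extendReal p) volume a b :=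
    fun a b => (continuous_extendReal p).intervalIntegrable a b
  have hn : ∀ a b, IntervalIntegrable (fun t => ‖extendReal p t‖) volume a b :=
    fun a b => (continuous_extendReal p).norm.intervalIntegrable a b
  have h1 : ‖∫ t in (r * x)..c, extendReal p t‖ ≤ (1 - r) * M := by
    rcases le_total ρ (r * x) with h | h
    · rw [hc, max_eq_left h, intervalIntegral.integral_same, norm_zero]
      exact mul_nonneg (by linarith) hM0
    · have hcρ : c = ρ := max_eq_right h
      have h2 : ‖∫ t in (r * x)..c, extendReal p t‖ ≤ M * |c - r * x| := by
        refine intervalIntegral.norm_integral_le_of_norm_le_const fun t ht => ?_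
        rw [Set.uIoc_of_le hrc] at ht
        have ht' : t ∈ Set.Icc (0 : ℝ) 1 :=
          ⟨hrx0.trans ht.1.le, (ht.2.trans hcx).trans hx⟩
        rw [extendReal_of_mem p ht']
        exact hM _ (ht.2.trans hcρ.le)
      refine h2.trans ?_
      rw [abs_of_nonneg (by linarith), mul_comm, hcρ]
      refine mul_le_mul_of_nonneg_right ?_ hM0
      have : r * ρ ≤ r * x := mul_le_mul_of_nonneg_left hρx hr
      have h3 : (1 - r) * ρ ≤ (1 - r) * 1 :=
        mul_le_mul_of_nonneg_left (hρx.trans hx) (by linarith)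
      linarith
  have e1 : ∫ t in (r * x)..x, extendReal p t
      = (∫ t in (r * x)..c, extendReal p t) + ∫ t in c..x, extendReal p t :=
    (intervalIntegral.integral_add_adjacent_intervals (hi _ _) (hi _ _)).symm
  have e2 : ∫ t in ρ..1, extendReal p t = (∫ t in ρ..c, extendReal p t) +
      (∫ t in c..x, extendReal p t) + ∫ t in x..1, extendReal p t := by
    rw [intervalIntegral.integral_add_adjacent_intervals (hi _ _) (hi _ _),
      intervalIntegral.integral_add_adjacent_intervals (hi _ _) (hi _ _)]
  have e3 : ∫ t : I, ‖p t‖ = (∫ t in (0 : ℝ)..ρ, ‖extendReal p t‖) +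
      (∫ t in ρ..c, ‖extendReal p t‖) +
      (∫ t in c..x, ‖extendReal p t‖) + ∫ t in x..1, ‖extendReal p t‖ := by
    rw [← integral_norm_extendReal,
      intervalIntegral.integral_add_adjacent_intervals (hn _ _) (hn _ _),
      intervalIntegral.integral_add_adjacent_intervals (hn _ _) (hn _ _),
      intervalIntegral.integral_add_adjacent_intervals (hn _ _) (hn _ _)]
  have n0 : 0 ≤ ∫ t in (0 : ℝ)..ρ, ‖extendReal p t‖ :=
    intervalIntegral.integral_nonneg hρ fun _ _ => norm_nonneg _
  have n1 : ‖∫ t in ρ..c, extendReal p t‖ ≤ _ :=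
    intervalIntegral.norm_integral_le_integral_norm hρc
  have n2 : ‖∫ t in c..x, extendReal p t‖ ≤ _ :=
    intervalIntegral.norm_integral_le_integral_norm hcx
  have n3 : ‖∫ t in x..1, extendReal p t‖ ≤ _ :=
    intervalIntegral.norm_integral_le_integral_norm hx
  rw [e1, e2, e3]
  set u0 := ∫ t in (r * x)..c, extendReal p t
  set u1 := ∫ t in ρ..c, extendReal p t
  set u2 := ∫ t in c..x, extendReal p t
  set u3 := ∫ t in x..1, extendReal p t
  have hhalf : ‖(1 / 2 : 𝕜)‖ = 1 / 2 := by simp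
  -- Since u2 - (u1 + u2 + u3)/2 = (u2 - u1 - u3)/2 and the three intervals do not overlap, at most
  -- half the L¹ norm survives.
  calc ‖u0 + u2 - 1 / 2 * (u1 + u2 + u3)‖
      = ‖u0 + (1 / 2 * (u2 - u1 - u3))‖ := by congr 1; ring
    _ ≤ ‖u0‖ + 1 / 2 * (‖u2‖ + ‖u1‖ + ‖u3‖) := by
        refine (norm_add_le _ _).trans (add_le_add le_rfl ?_)
        rw [norm_mul, hhalf]
        refine mul_le_mul_of_nonneg_left ?_ (by norm_num)
        exact (norm_sub_le _ _).trans (add_le_add (norm_sub_le _ _) le_rfl)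
    _ ≤ _ := by linarith

/-- The pointwise estimate behind the distance to the compact operators. -/
lemma norm_mul_average_sub_le (q p : C(I, 𝕜)) (l : ℝ≥0) {ρ M : ℝ} (r : I) (hρ : 0 < ρ) (hρ1 : ρ < 1)
    (hM : ∀ y : I, (y : ℝ) ≤ ρ → ‖p y‖ ≤ M * (∫ t : I, ‖p t‖)) (hM0 : 0 ≤ M) (x : I) :
    ‖q x * (average p x - ((r : ℝ) : 𝕜) * average (dilation r p) x
        - 1 / 2 * (∫ t in ρ..1, extendReal p t) * monomial 𝕜 l x)‖
      ≤ (‖q * monomial 𝕜 l‖ / 2 + ‖q‖ * ((1 - r) * M + (ρ⁻¹ - ρ ^ (l : ℝ)))) * (∫ t : I, ‖p t‖) := by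
  set N := ∫ t : I, ‖p t‖
  have hN : 0 ≤ N := integral_nonneg fun _ => norm_nonneg _
  have hq := q.norm_coe_le_norm x
  have hr0 : (0 : ℝ) ≤ r := r.2.1
  have hr1 : (r : ℝ) ≤ 1 := r.2.2
  have hχ : ‖q x‖ * ‖monomial 𝕜 l x‖ ≤ ‖q * monomial 𝕜 l‖ := by
    rw [← norm_mul]
    exact (q * monomial 𝕜 l).norm_coe_le_norm x
  have hL : ‖∫ t in ρ..1, extendReal p t‖ ≤ N :=
    norm_intervalIntegral_extendReal_le p hρ.le hρ1.le le_rfl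
  have hhalf : ‖(1 / 2 : 𝕜)‖ = 1 / 2 := by simp
  have hgap : 0 ≤ ρ⁻¹ - ρ ^ (l : ℝ) := by
    have h1 : ρ ^ (l : ℝ) ≤ 1 := Real.rpow_le_one hρ.le hρ1.le l.coe_nonneg
    have h2 : 1 ≤ ρ⁻¹ := (one_le_inv₀ hρ).2 hρ1.le
    linarith
  set L := ∫ t in ρ..1, extendReal p t
  set m := monomial 𝕜 l x with hm
  rw [average_sub_dilation]
  rcases le_total (x : ℝ) ρ with hx | hx
  · have h1 : ‖∫ t in (r : ℝ)..1, extendReal p (t * x)‖ ≤ (M * N) * |1 - (r : ℝ)| := by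
      refine intervalIntegral.norm_integral_le_of_norm_le_const fun t ht => ?_
      rw [Set.uIoc_of_le hr1] at ht
      have ht' : t * x ≤ x := mul_le_of_le_one_left x.2.1 ht.2
      have ht0 : 0 ≤ t * x := mul_nonneg (hr0.trans ht.1.le) x.2.1
      rw [extendReal_of_mem p ⟨ht0, ht'.trans x.2.2⟩]
      exact hM _ (ht'.trans hx)
    rw [abs_of_nonneg (by linarith)] at h1
    calc _ ≤ ‖q x‖ * (M * N * (1 - r) + 1 / 2 * N * ‖m‖) := by
          rw [norm_mul]
          gcongr
          refine (norm_sub_le _ _).trans (add_le_add h1 ?_)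
          rw [norm_mul, norm_mul, hhalf]
          gcongr
      _ = ‖q x‖ * ((1 - r) * M) * N + 1 / 2 * (‖q x‖ * ‖m‖) * N := by ring
      _ ≤ ‖q‖ * ((1 - r) * M + (ρ⁻¹ - ρ ^ (l : ℝ))) * N + 1 / 2 * ‖q * monomial 𝕜 l‖ * N := by
          have : 0 ≤ (1 - r : ℝ) := by linarith
          gcongr
          linarith
      _ = _ := by ring
  · have hx0 : (0 : ℝ) < x := hρ.trans_le hx
    have hxk : ((x : ℝ) : 𝕜) ≠ 0 := by exact_mod_cast hx0.ne'
    have h1 := integral_extendReal_mul p r x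
    have h2 := norm_integral_sub_half_le p hρ.le hr0 hr1 hx x.2.2 hM
    have h3 : ‖∫ t in (r * x : ℝ)..x, extendReal p t‖ ≤ N :=
      norm_intervalIntegral_extendReal_le p (mul_nonneg hr0 x.2.1)
        (mul_le_of_le_one_left x.2.1 hr1) x.2.2
    set Y := ∫ t in (r * x : ℝ)..x, extendReal p t
    rw [show ∫ t in (r : ℝ)..1, extendReal p (t * x) = ((x : ℝ) : 𝕜)⁻¹ * Y by
      rw [← h1, inv_mul_cancel_left₀ hxk]]
    have h4 : ‖((x : ℝ) : 𝕜)⁻¹ - m‖ ≤ ρ⁻¹ - ρ ^ (l : ℝ) := by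
      have h5 : ((x : ℝ) : 𝕜)⁻¹ - m = (((x : ℝ)⁻¹ - (x : ℝ) ^ (l : ℝ) : ℝ) : 𝕜) := by
        push_cast; rfl
      have h6 : (x : ℝ) ^ (l : ℝ) ≤ 1 := Real.rpow_le_one hx0.le x.2.2 l.coe_nonneg
      have h7 : 1 ≤ (x : ℝ)⁻¹ := (one_le_inv₀ hx0).2 x.2.2
      rw [h5, RCLike.norm_ofReal, abs_of_nonneg (by linarith)]
      have h8 : (x : ℝ)⁻¹ ≤ ρ⁻¹ := inv_anti₀ hρ hx
      have h9 : ρ ^ (l : ℝ) ≤ (x : ℝ) ^ (l : ℝ) := Real.rpow_le_rpow hρ.le hx l.coe_nonneg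
      linarith
    have hm1 : ‖m‖ ≤ 1 := by
      have h6 : (x : ℝ) ^ (l : ℝ) ≤ 1 := Real.rpow_le_one hx0.le x.2.2 l.coe_nonneg
      change ‖(((x : ℝ) ^ (l : ℝ) : ℝ) : 𝕜)‖ ≤ 1
      rw [RCLike.norm_ofReal, abs_of_nonneg (Real.rpow_nonneg hx0.le _)]
      exact h6
    -- Trading 1/x for x^l costs at most ρ⁻¹ - ρ^l on [ρ, 1] and puts x^l in front of the halved
    -- term, so that ‖q x^l‖ appears there instead of ‖q‖.
    calc _ = ‖q x * ((((x : ℝ) : 𝕜)⁻¹ - m) * Y + m * (Y - 1 / 2 * L))‖ := by congr 1; ring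
      _ ≤ ‖q x‖ * ((ρ⁻¹ - ρ ^ (l : ℝ)) * N + ‖m‖ * (1 / 2 * N + (1 - r) * (M * N))) := by
          rw [norm_mul]
          gcongr
          refine (norm_add_le _ _).trans (add_le_add ?_ ?_)
          · rw [norm_mul]; gcongr
          · rw [norm_mul]; gcongr
      _ = 1 / 2 * (‖q x‖ * ‖m‖) * N + ‖q x‖ * ((ρ⁻¹ - ρ ^ (l : ℝ)) + ‖m‖ * ((1 - r) * M)) * N := by
          ring
      _ ≤ 1 / 2 * ‖q * monomial 𝕜 l‖ * N +
          ‖q‖ * ((ρ⁻¹ - ρ ^ (l : ℝ)) + 1 * ((1 - r) * M)) * N := by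
          have : 0 ≤ (1 - r : ℝ) := by linarith
          gcongr
      _ = _ := by ring

/-! ### Extension by density and compactness -/

/-- The class in `M_Λ^1` of a Müntz polynomial. -/
noncomputable def toSpaceOne (Λ : ℕ → ℝ≥0) : polySpace 𝕜 Λ →ₗ[𝕜] spaceOne 𝕜 Λ :=
  ((ContinuousMap.toLp 1 (volume : Measure I) 𝕜 :
    C(I, 𝕜) →L[𝕜] Lp 𝕜 1 (volume : Measure I)).toLinearMap ∘ₗ
      (polySpace 𝕜 Λ).subtype).codRestrict (spaceOne 𝕜 Λ) fun p =>
    Submodule.le_topologicalClosure _ (Submodule.mem_map_of_mem p.2)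

lemma toSpaceOne_ae (Λ : ℕ → ℝ≥0) (p : polySpace 𝕜 Λ) :
    ((toSpaceOne Λ p : Lp 𝕜 1 (volume : Measure I)) : I → 𝕜) =ᵐ[volume] (p : C(I, 𝕜)) :=
  ContinuousMap.coeFn_toLp (volume : Measure I) (p : C(I, 𝕜))

lemma norm_toSpaceOne (Λ : ℕ → ℝ≥0) (p : polySpace 𝕜 Λ) :
    ‖toSpaceOne Λ p‖ = ∫ t : I, ‖(p : C(I, 𝕜)) t‖ := by
  rw [Submodule.coe_norm, L1.norm_eq_integral_norm]
  refine integral_congr_ae ?_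
  filter_upwards [toSpaceOne_ae Λ p] with t ht
  rw [ht]

lemma denseRange_toSpaceOne (Λ : ℕ → ℝ≥0) : DenseRange (toSpaceOne (𝕜 := 𝕜) Λ) := by
  intro f
  rw [closure_subtype]
  have h : (Subtype.val '' Set.range (toSpaceOne (𝕜 := 𝕜) Λ)) = (((polySpace 𝕜 Λ).map
      (ContinuousMap.toLp 1 (volume : Measure I) 𝕜 :
        C(I, 𝕜) →L[𝕜] Lp 𝕜 1 (volume : Measure I)).toLinearMap : Submodule 𝕜 _) : Set _) := by
    ext g
    constructor
    · rintro ⟨_, ⟨p, rfl⟩, rfl⟩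
      exact Submodule.mem_map_of_mem p.2
    · rintro ⟨p, hp, rfl⟩
      exact ⟨_, ⟨⟨p, hp⟩, rfl⟩, rfl⟩
  rw [h]
  exact f.2

lemma exists_extendOfNorm {E G F : Type*} [AddCommGroup E] [Module 𝕜 E]
    [SeminormedAddCommGroup G] [NormedSpace 𝕜 G] [NormedAddCommGroup F] [NormedSpace 𝕜 F]
    [CompleteSpace F] (T : E →ₗ[𝕜] F) (e : E →ₗ[𝕜] G) (he : DenseRange e)
    (h : ∃ C, ∀ p, ‖T p‖ ≤ C * ‖e p‖) : ∃ S : G →L[𝕜] F, ∀ p, S (e p) = T p :=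
  ⟨T.extendOfNorm e, LinearMap.extendOfNorm_eq he h⟩

/-- An L¹ estimate on polynomials defines an operator on M_Λ^1, provided the target is complete. Q_Λ
may fail to be, so the averages are built into C, restricted to M_Λ^∞, and multiplied by q last. -/
lemma exists_extension {F : Type*} [NormedAddCommGroup F] [NormedSpace 𝕜 F] [CompleteSpace F]
    (Λ : ℕ → ℝ≥0) (T : polySpace 𝕜 Λ →ₗ[𝕜] F) (C : ℝ)
    (hT : ∀ p, ‖T p‖ ≤ C * ∫ t : I, ‖(p : C(I, 𝕜)) t‖) :
    ∃ S : spaceOne 𝕜 Λ →L[𝕜] F, ∀ p, S (toSpaceOne Λ p) = T p := by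
  have h : ∃ C, ∀ p, ‖T p‖ ≤ C * ‖toSpaceOne Λ p‖ := by
    refine ⟨C, fun p => ?_⟩
    rw [norm_toSpaceOne]
    exact hT p
  have hd : DenseRange (toSpaceOne (𝕜 := 𝕜) Λ) := denseRange_toSpaceOne (𝕜 := 𝕜) Λ
  have h2 := exists_extendOfNorm (E := polySpace 𝕜 Λ) (G := spaceOne 𝕜 Λ) (F := F) (𝕜 := 𝕜) T
    (toSpaceOne Λ)
  exact h2 hd h

lemma isClosed_spaceInf (Λ : ℕ → ℝ≥0) : IsClosed (spaceInf 𝕜 Λ : Set C(I, 𝕜)) :=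
  Submodule.isClosed_topologicalClosure _

lemma apply_mem_spaceInf {Λ : ℕ → ℝ≥0} (S : spaceOne 𝕜 Λ →L[𝕜] C(I, 𝕜))
    (hS : ∀ p, S (toSpaceOne Λ p) ∈ polySpace 𝕜 Λ) (f : spaceOne 𝕜 Λ) : S f ∈ spaceInf 𝕜 Λ :=
  (denseRange_toSpaceOne Λ).induction_on f ((isClosed_spaceInf Λ).preimage S.continuous)
    fun p => Submodule.le_topologicalClosure _ (hS p)

lemma isCompact_closure_of_modulus {A : Set C(I, 𝕜)} {B : ℝ} (V : I → I → ℝ)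
    (hV : ∀ x, Filter.Tendsto (V x) (nhds x) (nhds 0)) (hB : ∀ f ∈ A, ∀ x, ‖f x‖ ≤ B)
    (hA : ∀ f ∈ A, ∀ x y, ‖f x - f y‖ ≤ V x y) : IsCompact (closure A) := by
  set e := ContinuousMap.isometryEquivBoundedOfCompact I 𝕜
  have h := BoundedContinuousFunction.arzela_ascoli (Metric.closedBall (0 : 𝕜) B)
    (isCompact_closedBall 0 B) (e '' A) (by
      rintro _ x ⟨f, hf, rfl⟩
      exact mem_closedBall_zero_iff.2 (hB f hf x)) (by
      intro x
      refine Metric.equicontinuousAt_of_continuity_modulus (V x) (hV x) _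
        (Filter.Eventually.of_forall fun y => ?_)
      rintro ⟨_, f, hf, rfl⟩
      rw [dist_eq_norm]
      exact hA f hf x y)
  change IsCompact (closure (e.toHomeomorph '' A)) at h
  rw [← e.toHomeomorph.image_closure] at h
  exact e.toHomeomorph.isCompact_image.1 h

/-- The dilation by `r < 1` extends to a compact operator from `M_Λ^1` to `C([0,1])`. -/
theorem exists_dilation (Λ : ℕ → ℝ≥0) (hΛ : StrictMono Λ)
    (hMuntz : Summable fun k => (Λ k)⁻¹) {r : I} (hr : 0 < r) (hr1 : r < 1) :
    ∃ S : spaceOne 𝕜 Λ →L[𝕜] C(I, 𝕜), IsCompactOperator S ∧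
      ∀ p : polySpace 𝕜 Λ, S (toSpaceOne Λ p) = dilation r p := by
  obtain ⟨V, B, hB, hV, h⟩ := exists_modulus_polySpace (𝕜 := 𝕜) Λ hΛ hMuntz (ρ := r) hr hr1
  have hle : ∀ x : I, ((r * x : I) : ℝ) ≤ r := fun x => mul_le_of_le_one_right r.2.1 x.2.2
  have hN : ∀ p : C(I, 𝕜), 0 ≤ ∫ t : I, ‖p t‖ := fun p => integral_nonneg fun _ => norm_nonneg _
  obtain ⟨S, hS⟩ := exists_extension Λ
    ((dilation r).toLinearMap ∘ₗ (polySpace 𝕜 Λ).subtype) B fun p => by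
      refine (ContinuousMap.norm_le _ (mul_nonneg hB (hN p))).2 fun x => ?_
      exact (h p p.2 (r * x) (hle x)).1
  refine ⟨S, ?_, hS⟩
  set A : Set C(I, 𝕜) := {g | ∃ p ∈ polySpace 𝕜 Λ, (∫ t : I, ‖p t‖) ≤ 1 ∧ g = dilation r p}
  have hA : IsCompact (closure A) := by
    refine isCompact_closure_of_modulus (B := B) (fun x y => |V (r * x : I) (r * y : I)|) ?_ ?_ ?_
    · intro x
      have h1 : Filter.Tendsto (fun y : I => ((r * y : I) : ℝ)) (nhds x)
          (nhdsWithin ((r * x : I) : ℝ) (Set.Icc 0 (r : ℝ))) := by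
        refine tendsto_nhdsWithin_iff.2 ⟨?_, Filter.Eventually.of_forall fun y =>
          ⟨(r * y).2.1, hle y⟩⟩
        have : Continuous fun y : I => ((r * y : I) : ℝ) := by fun_prop
        exact this.tendsto x
      simpa using ((hV _ ⟨(r * x).2.1, hle x⟩).comp h1).abs
    · rintro _ ⟨p, hp, hp1, rfl⟩ x
      refine ((h p hp (r * x) (hle x)).1).trans ?_
      exact mul_le_of_le_one_right hB hp1
    · rintro _ ⟨p, hp, hp1, rfl⟩ x y
      refine ((h p hp (r * x) (hle x)).2 (r * y) (hle y)).trans ?_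
      exact (mul_le_mul_of_nonneg_right (le_abs_self _) (hN p)).trans
        (mul_le_of_le_one_right (abs_nonneg _) hp1)
  refine (isCompactOperator_iff_image_ball_subset_compact S.toLinearMap one_pos).2
    ⟨closure A, hA, ?_⟩
  rintro _ ⟨f, hf, rfl⟩
  -- Polynomial classes are dense in the open unit ball, so its image stays in the closure of A.
  have h1 := (denseRange_toSpaceOne (𝕜 := 𝕜) Λ).open_subset_closure_inter
    (Metric.isOpen_ball (x := (0 : spaceOne 𝕜 Λ)) (ε := 1)) hf
  have h2 := image_closure_subset_closure_image S.continuous (Set.mem_image_of_mem S h1)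
  refine closure_mono ?_ h2
  rintro _ ⟨_, ⟨hp, p, rfl⟩, rfl⟩
  refine ⟨p, p.2, ?_, hS p⟩
  rw [mem_ball_zero_iff, norm_toSpaceOne] at hp
  exact hp.le

/-- The averaging operator extends to a bounded operator from `M_Λ^1` to `M_Λ^∞`. -/
theorem exists_average (Λ : ℕ → ℝ≥0) (hΛ : StrictMono Λ) (hMuntz : Summable fun k => (Λ k)⁻¹) :
    ∃ S : spaceOne 𝕜 Λ →L[𝕜] spaceInf 𝕜 Λ,
      ∀ p : polySpace 𝕜 Λ, (S (toSpaceOne Λ p) : C(I, 𝕜)) = average (p : C(I, 𝕜)) := by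
  obtain ⟨V, B, hB, hV, h⟩ := exists_modulus_polySpace (𝕜 := 𝕜) Λ hΛ hMuntz (ρ := 1 / 2)
    (by norm_num) (by norm_num)
  have hN : ∀ p : C(I, 𝕜), 0 ≤ ∫ t : I, ‖p t‖ := fun p => integral_nonneg fun _ => norm_nonneg _
  obtain ⟨S, hS⟩ := exists_extension Λ
    ((average (𝕜 := 𝕜)).toLinearMap ∘ₗ (polySpace 𝕜 Λ).subtype) (B + 2) fun p => by
      refine (ContinuousMap.norm_le _ (mul_nonneg (by linarith) (hN p))).2 fun x => ?_
      change ‖average (p : C(I, 𝕜)) x‖ ≤ _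
      have hNp := hN p
      -- For x ≤ 1/2 only values of p on [0, 1/2] are averaged, which gives B; for x ≥ 1/2 the
      -- factor 1/x is at most 2.
      rcases le_total (x : ℝ) (1 / 2) with hx | hx
      · refine (norm_integral_unitInterval_le fun t => (h p p.2 (t * x)
          ((mul_le_of_le_one_left x.2.1 t.2.2).trans hx)).1).trans ?_
        gcongr
        linarith
      · have h1 := mul_average (p : C(I, 𝕜)) x
        have h2 : ‖∫ t in Set.Icc 0 x, (p : C(I, 𝕜)) t‖ ≤ ∫ t : I, ‖(p : C(I, 𝕜)) t‖ :=
          (norm_integral_le_integral_norm _).trans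
            (setIntegral_le_integral (integrable_unitInterval _).norm
              (Filter.Eventually.of_forall fun _ => norm_nonneg _))
        rw [← h1, norm_mul, RCLike.norm_ofReal, abs_of_nonneg x.2.1] at h2
        have h3 := norm_nonneg (average (p : C(I, 𝕜)) x)
        nlinarith [mul_nonneg hB hNp]
  exact ⟨S.codRestrict _ (apply_mem_spaceInf S fun p => by
    rw [hS]; exact average_mem_polySpace p.2), hS⟩

theorem exists_average_dilation (Λ : ℕ → ℝ≥0) (hΛ : StrictMono Λ)
    (hMuntz : Summable fun k => (Λ k)⁻¹) {r : I} (hr : 0 < r) (hr1 : r < 1) :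
    ∃ S : spaceOne 𝕜 Λ →L[𝕜] spaceInf 𝕜 Λ, IsCompactOperator S ∧
      ∀ p : polySpace 𝕜 Λ, (S (toSpaceOne Λ p) : C(I, 𝕜)) = average (dilation r (p : C(I, 𝕜))) := by
  obtain ⟨T, hTc, hT⟩ := exists_dilation (𝕜 := 𝕜) Λ hΛ hMuntz hr hr1
  have hmem := apply_mem_spaceInf (average ∘L T) fun p => by
    rw [ContinuousLinearMap.comp_apply, hT]
    exact average_mem_polySpace (dilation_mem_polySpace r p.2)
  refine ⟨(average ∘L T).codRestrict _ hmem,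
    (hTc.clm_comp average).codRestrict hmem (isClosed_spaceInf Λ), fun p => ?_⟩
  change average (T (toSpaceOne Λ p)) = _
  rw [hT]

lemma exists_tailIntegral (Λ : ℕ → ℝ≥0) {ρ : ℝ} (hρ : 0 ≤ ρ) (hρ1 : ρ ≤ 1) :
    ∃ L : spaceOne 𝕜 Λ →L[𝕜] 𝕜, ∀ p : polySpace 𝕜 Λ,
      L (toSpaceOne Λ p) = ∫ t in ρ..1, extendReal (p : C(I, 𝕜)) t := by
  refine exists_extension Λ
    { toFun := fun p : polySpace 𝕜 Λ => ∫ t in ρ..1, extendReal (p : C(I, 𝕜)) t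
      map_add' := fun p p' => intervalIntegral.integral_add
        ((continuous_extendReal _).intervalIntegrable _ _)
        ((continuous_extendReal _).intervalIntegrable _ _)
      map_smul' := fun c p =>
        intervalIntegral.integral_const_mul c fun t => extendReal (p : C(I, 𝕜)) t } 1 fun p => ?_
  rw [one_mul]
  exact norm_intervalIntegral_extendReal_le _ hρ hρ1 le_rfl

/-- Up to an arbitrarily small error, the averaging operator is a compact operator plus an operator
whose weighted norm is at most half that of the weight. -/
theorem exists_compact_approx (Λ : ℕ → ℝ≥0) (hΛ : StrictMono Λ)
    (hMuntz : Summable fun k => (Λ k)⁻¹) (H : spaceOne 𝕜 Λ →L[𝕜] spaceInf 𝕜 Λ)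
    (hH : ∀ p : polySpace 𝕜 Λ, (H (toSpaceOne Λ p) : C(I, 𝕜)) = average (p : C(I, 𝕜)))
    (q : C(I, 𝕜)) (l : ℝ≥0) {η : ℝ} (hη : 0 < η) :
    ∃ (K : spaceOne 𝕜 Λ →L[𝕜] spaceInf 𝕜 Λ) (L : spaceOne 𝕜 Λ →L[𝕜] 𝕜), IsCompactOperator K ∧
      ∀ f, ‖q * ((H f : C(I, 𝕜)) - K f - L f • monomial 𝕜 l)‖ ≤
        (‖q * monomial 𝕜 l‖ / 2 + η) * ‖f‖ := by
  obtain ⟨ρ, hρ, hρ1, hgap⟩ : ∃ ρ : ℝ, 0 < ρ ∧ ρ < 1 ∧ ‖q‖ * (ρ⁻¹ - ρ ^ (l : ℝ)) < η / 2 := by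
    have hc : ContinuousAt (fun ρ : ℝ => ‖q‖ * (ρ⁻¹ - ρ ^ (l : ℝ))) 1 :=
      continuousAt_const.mul ((continuousAt_inv₀ one_ne_zero).sub
        (Real.continuous_rpow_const l.coe_nonneg).continuousAt)
    have h1 := (hc.tendsto.mono_left (nhdsWithin_le_nhds (s := Set.Iio 1))).eventually_lt_const
      (u := η / 2) (by simpa using hη)
    obtain ⟨ρ, h2, h3⟩ := (h1.and (Ioo_mem_nhdsLT zero_lt_one)).exists
    exact ⟨ρ, h3.1, h3.2, h2⟩
  obtain ⟨V, M, hM0, -, hM⟩ := exists_modulus_polySpace (𝕜 := 𝕜) Λ hΛ hMuntz hρ hρ1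
  -- The choice of r comes after that of ρ because M depends on ρ.
  obtain ⟨r, hr, hr1, hrM⟩ : ∃ r : I, 0 < r ∧ r < 1 ∧ ‖q‖ * ((1 - r) * M) < η / 2 := by
    have hc : ContinuousAt (fun r : ℝ => ‖q‖ * ((1 - r) * M)) 1 := by fun_prop
    have h1 := (hc.tendsto.mono_left (nhdsWithin_le_nhds (s := Set.Iio 1))).eventually_lt_const
      (u := η / 2) (by simpa using hη)
    obtain ⟨r, h2, h3⟩ := (h1.and (Ioo_mem_nhdsLT zero_lt_one)).exists
    exact ⟨⟨r, h3.1.le, h3.2.le⟩, h3.1, h3.2, h2⟩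
  obtain ⟨K, hKc, hK⟩ := exists_average_dilation (𝕜 := 𝕜) Λ hΛ hMuntz hr hr1
  obtain ⟨L, hL⟩ := exists_tailIntegral (𝕜 := 𝕜) Λ hρ.le hρ1.le
  refine ⟨((r : ℝ) : 𝕜) • K, (1 / 2 : 𝕜) • L, hKc.smul ((r : ℝ) : 𝕜), fun f => ?_⟩
  refine (denseRange_toSpaceOne Λ).induction_on f (isClosed_le ?_ ?_) fun p => ?_
  · have h1 : Continuous fun f => (H f : C(I, 𝕜)) := continuous_subtype_val.comp H.continuous
    have h2 : Continuous fun f => ((((r : ℝ) : 𝕜) • K) f : C(I, 𝕜)) :=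
      continuous_subtype_val.comp (((r : ℝ) : 𝕜) • K).continuous
    have h3 := ((1 / 2 : 𝕜) • L).continuous
    exact (continuous_const.mul ((h1.sub h2).sub (h3.smul continuous_const))).norm
  · fun_prop
  · have hN : 0 ≤ ‖toSpaceOne Λ p‖ := norm_nonneg _
    have hgap' : 0 ≤ ρ⁻¹ := by positivity
    have hb := norm_mul_average_sub_le q (p : C(I, 𝕜)) l r hρ hρ1
      (fun y hy => (hM p p.2 y hy).1) hM0
    rw [← norm_toSpaceOne] at hb
    have hle : (‖q * monomial 𝕜 l‖ / 2 + ‖q‖ * ((1 - r) * M + (ρ⁻¹ - ρ ^ (l : ℝ)))) *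
        ‖toSpaceOne Λ p‖ ≤ (‖q * monomial 𝕜 l‖ / 2 + η) * ‖toSpaceOne Λ p‖ := by
      gcongr
      rw [mul_add]
      linarith
    refine (ContinuousMap.norm_le _ (by positivity)).2 fun x => ?_
    refine le_trans (le_of_eq ?_) ((hb x).trans hle)
    have h4 : ((((r : ℝ) : 𝕜) • K) (toSpaceOne Λ p) : C(I, 𝕜))
        = ((r : ℝ) : 𝕜) • average (dilation r (p : C(I, 𝕜))) := by
      rw [← hK]; rfl
    rw [hH, h4, _root_.smul_apply, hL]
    rfl

/-! ### Integral formula and continuous representatives -/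

/-- The supremum norm on `M_Λ^∞`. -/
noncomputable instance (Λ : ℕ → ℝ≥0) : NormedAddCommGroup (spaceInf 𝕜 Λ) :=
  Submodule.normedAddCommGroup _

noncomputable instance (Λ : ℕ → ℝ≥0) : NormedSpace 𝕜 (spaceInf 𝕜 Λ) :=
  Submodule.normedSpace _

lemma mul_eq_setIntegral {Λ : ℕ → ℝ≥0} (H : spaceOne 𝕜 Λ →L[𝕜] spaceInf 𝕜 Λ)
    (hH : ∀ p : polySpace 𝕜 Λ, (H (toSpaceOne Λ p) : C(I, 𝕜)) = average (p : C(I, 𝕜)))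
    (f : spaceOne 𝕜 Λ) (x : I) :
    ((x : ℝ) : 𝕜) * (H f : C(I, 𝕜)) x
      = ∫ t in Set.Icc 0 x, (f : Lp 𝕜 1 (volume : Measure I)) t := by
  refine (denseRange_toSpaceOne Λ).induction_on f (isClosed_eq ?_ ?_) fun p => ?_
  · have h1 : Continuous fun f => (H f : C(I, 𝕜)) := continuous_subtype_val.comp H.continuous
    exact continuous_const.mul ((continuous_eval_const x).comp h1)
  · exact (continuous_setIntegral (μ := (volume : Measure I)) (E := 𝕜) (Set.Icc 0 x)).comp
      continuous_subtype_val
  · rw [hH, mul_average]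
    refine integral_congr_ae (ae_restrict_of_ae ?_)
    filter_upwards [toSpaceOne_ae Λ p] with t ht
    rw [ht]

/-- Elements of `M_Λ^1` are continuous on `[0,1)`. -/
theorem exists_continuousOn_representative {Λ : ℕ → ℝ≥0} (hΛ : StrictMono Λ)
    (hMuntz : Summable fun k => (Λ k)⁻¹) (H : spaceOne 𝕜 Λ →L[𝕜] spaceInf 𝕜 Λ)
    (hH : ∀ p : polySpace 𝕜 Λ, (H (toSpaceOne Λ p) : C(I, 𝕜)) = average (p : C(I, 𝕜)))
    (f : spaceOne 𝕜 Λ) :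
    ∃ g : I → 𝕜, ContinuousOn g {x | x < 1} ∧
      (f : Lp 𝕜 1 (volume : Measure I)) =ᵐ[volume] g ∧ g 0 = (H f : C(I, 𝕜)) 0 := by
  obtain ⟨v, hv, hvf⟩ := mem_closure_iff_seq_limit.1 (denseRange_toSpaceOne Λ f)
  choose u hu using hv
  have hu' : v = fun n => toSpaceOne Λ (u n) := funext fun n => (hu n).symm
  subst hu'
  have hdil : ∀ r : I, 0 < r → r < 1 → ∃ F : C(I, 𝕜), ∀ y : I,
      Filter.Tendsto (fun n => (u n : C(I, 𝕜)) (r * y)) Filter.atTop (nhds (F y)) := by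
    intro r hr hr1
    obtain ⟨S, -, hS⟩ := exists_dilation (𝕜 := 𝕜) Λ hΛ hMuntz hr hr1
    refine ⟨S f, fun y => ?_⟩
    have h1 := ((continuous_eval_const (F := C(I, 𝕜)) y).tendsto (S f)).comp
      ((S.continuous.tendsto f).comp hvf)
    refine h1.congr fun n => ?_
    simp only [Function.comp_apply]
    rw [hS]
    rfl
  have hloc : ∀ x : I, x < 1 → ∃ (F : I → 𝕜), Continuous F ∧ ∀ᶠ y in nhds x,
      Filter.Tendsto (fun n => (u n : C(I, 𝕜)) y) Filter.atTop (nhds (F y)) := by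
    intro x hx
    have hx1 : (x : ℝ) < 1 := hx
    have hx0 := x.2.1
    -- Any r strictly between x and 1 serves: the dilation limit at y/r describes the pointwise
    -- limit for y near x.
    set r : I := ⟨((x : ℝ) + 1) / 2, by linarith, by linarith⟩ with hr
    have hr0 : (0 : ℝ) < r := by change (0 : ℝ) < ((x : ℝ) + 1) / 2; linarith
    have hr1 : (r : ℝ) < 1 := by change ((x : ℝ) + 1) / 2 < 1; linarith
    have hxr : x < r := by change (x : ℝ) < ((x : ℝ) + 1) / 2; linarith
    obtain ⟨F, hF⟩ := hdil r hr0 hr1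
    refine ⟨fun y => F (Set.projIcc 0 1 zero_le_one ((y : ℝ) / r)), ?_, ?_⟩
    · exact F.continuous.comp (continuous_projIcc.comp (by fun_prop))
    · filter_upwards [Iio_mem_nhds hxr] with y hy
      have hy : (y : ℝ) < r := hy
      have h1 := hF (Set.projIcc 0 1 zero_le_one ((y : ℝ) / r))
      have h2 : r * Set.projIcc 0 1 zero_le_one ((y : ℝ) / r) = y := by
        rw [Set.projIcc_of_mem zero_le_one
          (⟨div_nonneg y.2.1 hr0.le, (div_le_one hr0).2 hy.le⟩ : (y : ℝ) / r ∈ Set.Icc (0 : ℝ) 1)]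
        ext
        exact mul_div_cancel₀ _ hr0.ne'
      rwa [h2] at h1
  have hlim : ∀ x : I, ∃ z : 𝕜, x < 1 →
      Filter.Tendsto (fun n => (u n : C(I, 𝕜)) x) Filter.atTop (nhds z) := fun x => by
    by_cases hx : x < 1
    · obtain ⟨F, -, hF⟩ := hloc x hx
      exact ⟨F x, fun _ => hF.self_of_nhds⟩
    · exact ⟨0, fun h => absurd h hx⟩
  choose g hg using hlim
  refine ⟨g, fun x hx => ?_, ?_, ?_⟩
  · obtain ⟨F, hFc, hF⟩ := hloc x hx
    refine (hFc.continuousAt.congr ?_).continuousWithinAt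
    filter_upwards [hF, Iio_mem_nhds hx] with y hy hy1
    exact tendsto_nhds_unique hy (hg y hy1)
  · have h1 : Filter.Tendsto (fun n => ((toSpaceOne Λ (u n) : spaceOne 𝕜 Λ) :
        Lp 𝕜 1 (volume : Measure I))) Filter.atTop (nhds (f : Lp 𝕜 1 (volume : Measure I))) :=
      (continuous_subtype_val.tendsto f).comp hvf
    -- An a.e. convergent subsequence identifies the pointwise limit g with the class f away from
    -- the null set {1}.
    obtain ⟨ns, hns, hae⟩ := (tendstoInMeasure_of_tendsto_Lp h1).exists_seq_tendsto_ae
    have h2 := ae_all_iff.2 fun n => toSpaceOne_ae Λ (u n)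
    have h3 : ∀ᵐ x : I, x ≠ 1 := by
      rw [ae_iff]
      simp
    filter_upwards [hae, h2, h3] with x hx1 hx2 hx3
    refine tendsto_nhds_unique hx1 ?_
    refine ((hg x (lt_of_le_of_ne x.2.2 hx3)).comp hns.tendsto_atTop).congr fun n => ?_
    exact (hx2 (ns n)).symm
  · have h1 : Continuous fun f => (H f : C(I, 𝕜)) := continuous_subtype_val.comp H.continuous
    have h2 := (((continuous_eval_const (F := C(I, 𝕜)) (0 : I)).comp h1).tendsto f).comp
      hvf
    refine tendsto_nhds_unique (hg 0 zero_lt_one) (h2.congr fun n => ?_)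
    simp only [Function.comp_apply]
    rw [hH, average_zero]

/-- If g ≠ g' throughout a neighbourhood of 0, some interval [0, b) with b > 0 would be null. This
makes f(0) well defined. -/
lemma eq_at_zero_of_ae_eq {g g' : I → 𝕜} (hg : ContinuousOn g {x | x < 1})
    (hg' : ContinuousOn g' {x | x < 1}) (h : g =ᵐ[volume] g') : g 0 = g' 0 := by
  have hn : {x : I | x < 1} ∈ nhds (0 : I) := Iio_mem_nhds zero_lt_one
  refine tendsto_nhds_unique_of_frequently_eq (hg.continuousAt hn) (hg'.continuousAt hn) ?_
  intro hev
  obtain ⟨b, hb, hsub⟩ := exists_Ico_subset_of_mem_nhds hev ⟨1, zero_lt_one⟩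
  have h1 : volume (Set.Ico (0 : I) b) = 0 := measure_mono_null hsub h
  rw [unitInterval.volume_Ico] at h1
  have h2 : (0 : ℝ) < b := hb
  simp at h1
  linarith

/-! ### Weights and the two distance bounds -/

/-- Multiplication by `q` as an operator from `M_Λ^∞` to `Q_Λ`. -/
noncomputable def mulWeight (Λ : ℕ → ℝ≥0) (q : C(I, 𝕜)) :
    spaceInf 𝕜 Λ →L[𝕜] weightedSpace Λ q :=
  ((ContinuousLinearMap.mul 𝕜 C(I, 𝕜) q).comp (spaceInf 𝕜 Λ).subtypeL).codRestrict
    (weightedSpace Λ q) fun g => Submodule.mem_map_of_mem g.2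

lemma monomial_mem_spaceInf (Λ : ℕ → ℝ≥0) (k : ℕ) : monomial 𝕜 (Λ k) ∈ spaceInf 𝕜 Λ :=
  Submodule.le_topologicalClosure _ (Submodule.subset_span ⟨k, rfl⟩)

lemma norm_mul_monomial_le (q : C(I, 𝕜)) (l : ℝ≥0) : ‖q * monomial 𝕜 l‖ ≤ ‖q‖ := by
  refine (norm_mul_le _ _).trans (mul_le_of_le_one_right (norm_nonneg _) ?_)
  refine (ContinuousMap.norm_le _ zero_le_one).2 fun x => ?_
  change ‖(((x : ℝ) ^ (l : ℝ) : ℝ) : 𝕜)‖ ≤ 1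
  rw [RCLike.norm_ofReal, abs_of_nonneg (Real.rpow_nonneg x.2.1 _)]
  exact Real.rpow_le_one x.2.1 x.2.2 l.coe_nonneg

/-- Near 1, |q| is close to |q(1)|; on [0, b] with b < 1 the powers b^n tend to 0. -/
lemma exists_norm_mul_monomial_le (q : C(I, 𝕜)) {η : ℝ} (hη : 0 < η) :
    ∃ l : ℝ≥0, ‖q * monomial 𝕜 l‖ ≤ ‖q 1‖ + η := by
  have h1 : ∀ᶠ x in nhds (1 : I), ‖q x‖ < ‖q 1‖ + η :=
    (q.continuous.norm.tendsto 1).eventually_lt_const (by linarith)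
  obtain ⟨b, hb, hsub⟩ := exists_Ioc_subset_of_mem_nhds h1 ⟨0, zero_lt_one⟩
  have h2 : Filter.Tendsto (fun n : ℕ => ‖q‖ * (b : ℝ) ^ n) Filter.atTop (nhds 0) := by
    simpa using (tendsto_pow_atTop_nhds_zero_of_lt_one b.2.1 hb).const_mul ‖q‖
  obtain ⟨n, hn⟩ := (h2.eventually_lt_const hη).exists
  refine ⟨n, (ContinuousMap.norm_le _ (by positivity)).2 fun x => ?_⟩
  have hm : ‖monomial 𝕜 (n : ℝ≥0) x‖ = (x : ℝ) ^ n := by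
    change ‖(((x : ℝ) ^ (((n : ℝ≥0)) : ℝ) : ℝ) : 𝕜)‖ = _
    rw [RCLike.norm_ofReal, abs_of_nonneg (Real.rpow_nonneg x.2.1 _)]
    simp
  rw [ContinuousMap.mul_apply, norm_mul, hm]
  rcases le_or_gt x b with hx | hx
  · calc _ ≤ ‖q‖ * (b : ℝ) ^ n := by
          gcongr
          · exact pow_nonneg x.2.1 n
          · exact q.norm_coe_le_norm x
          · exact x.2.1
      _ ≤ _ := by linarith [norm_nonneg (q 1)]
  · exact (mul_le_of_le_one_right (norm_nonneg _) (pow_le_one₀ x.2.1 x.2.2)).trans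
      (hsub ⟨hx, x.2.2⟩).le

lemma isCompactOperator_smulRight {X Y : Type*} [NormedAddCommGroup X] [NormedSpace 𝕜 X]
    [NormedAddCommGroup Y] [NormedSpace 𝕜 Y] (L : X →L[𝕜] 𝕜) (y : Y) :
    IsCompactOperator (L.smulRight y) :=
  (isCompactOperator_of_locallyCompactSpace_dom L).clm_comp (ContinuousLinearMap.toSpanSingleton 𝕜 y)

lemma distCompact_le {X Y : Type*} [SeminormedAddCommGroup X] [NormedSpace 𝕜 X]
    [SeminormedAddCommGroup Y] [NormedSpace 𝕜 Y] (T : X →L[𝕜] Y) {C : ℝ} (hC : 0 ≤ C)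
    (h : ∀ η : ℝ, 0 < η → ∃ S : X →L[𝕜] Y, IsCompactOperator S ∧
      ∀ f, ‖T f - S f‖ ≤ (C + η) * ‖f‖) : distCompact T ≤ C := by
  refine le_of_forall_pos_le_add fun η hη => ?_
  obtain ⟨S, hS, hTS⟩ := h η hη
  refine (Metric.infDist_le_dist_of_mem (show S ∈ {S : X →L[𝕜] Y | IsCompactOperator S} from hS)).trans ?_
  rw [dist_eq_norm]
  exact ContinuousLinearMap.opNorm_le_bound _ (by positivity) hTS

end Muntz

theorem proposition4p4 {𝕜 : Type*} [RCLike 𝕜] (Λ : ℕ → ℝ≥0) (hΛ : StrictMono Λ)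
    (hMuntz : Summable fun k => (Λ k)⁻¹) (q : C(I, 𝕜)) :
    ∃ H : Muntz.spaceOne 𝕜 Λ →L[𝕜] Muntz.weightedSpace Λ q,
      (∀ f : Muntz.spaceOne 𝕜 Λ,
        Muntz.IsWeightedCesaro q (f : Lp 𝕜 1 (volume : Measure I)) ((H f : C(I, 𝕜)) : I → 𝕜)) ∧
      (∀ (f : Muntz.spaceOne 𝕜 Λ) (h : I → 𝕜),
        Muntz.IsWeightedCesaro q (f : Lp 𝕜 1 (volume : Measure I)) h →
          h = ((H f : C(I, 𝕜)) : I → 𝕜)) ∧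
      Muntz.distCompact H ≤ ‖q‖ / 2 ∧
      Muntz.distCompact ((Muntz.weightedSpace Λ q).subtypeL ∘L H) ≤ ‖q 1‖ / 2 := by
  obtain ⟨H, hH⟩ := Muntz.exists_average (𝕜 := 𝕜) Λ hΛ hMuntz
  have hval : ∀ (f : Muntz.spaceOne 𝕜 Λ) (x : I), 0 < x → q x * (H f : C(I, 𝕜)) x
      = q x / ((x : ℝ) : 𝕜) * ∫ t in Set.Icc 0 x, (f : Lp 𝕜 1 (volume : Measure I)) t := by
    intro f x hx
    have hx0 : ((x : ℝ) : 𝕜) ≠ 0 := by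
      have : (x : ℝ) ≠ 0 := (show (0 : ℝ) < x from hx).ne'
      exact_mod_cast this
    rw [← Muntz.mul_eq_setIntegral H hH f x]
    field_simp
  have hces : ∀ f : Muntz.spaceOne 𝕜 Λ, Muntz.IsWeightedCesaro q
      (f : Lp 𝕜 1 (volume : Measure I)) ((Muntz.mulWeight Λ q (H f) : C(I, 𝕜)) : I → 𝕜) := by
    intro f
    obtain ⟨g, hg, hfg, hg0⟩ := Muntz.exists_continuousOn_representative hΛ hMuntz H hH f
    refine ⟨g, hg, hfg, ?_, hval f⟩
    rw [hg0]
    rfl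
  refine ⟨Muntz.mulWeight Λ q ∘L H, hces, ?_, ?_, ?_⟩
  · rintro f h ⟨g', hg', hfg', h0, hx⟩
    obtain ⟨g, hg, hfg, hg0, hgx⟩ := hces f
    funext x
    rcases x.2.1.eq_or_lt with h1 | h1
    · have h2 : x = 0 := Subtype.ext h1.symm
      subst h2
      change h 0 = (Muntz.mulWeight Λ q (H f) : C(I, 𝕜)) 0
      rw [h0, hg0, Muntz.eq_at_zero_of_ae_eq hg' hg (hfg'.symm.trans hfg)]
    · exact (hx x h1).trans (hgx x h1).symm
  · refine Muntz.distCompact_le _ (by positivity) fun η hη => ?_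
    -- The exponent λ_0 belongs to Λ, so q x^{λ_0}, and with it the rank-one correction, lies in
    -- Q_Λ.
    obtain ⟨K, L, hK, hKL⟩ := Muntz.exists_compact_approx Λ hΛ hMuntz H hH q (Λ 0) hη
    set m : Muntz.spaceInf 𝕜 Λ := ⟨_, Muntz.monomial_mem_spaceInf (𝕜 := 𝕜) Λ 0⟩ with hm
    refine ⟨Muntz.mulWeight Λ q ∘L (K + L.smulRight m),
      (hK.add (Muntz.isCompactOperator_smulRight L m)).clm_comp (Muntz.mulWeight Λ q), fun f => ?_⟩
    have h1 : ((((Muntz.mulWeight Λ q ∘L H) f - (Muntz.mulWeight Λ q ∘L (K + L.smulRight m)) f :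
        Muntz.weightedSpace Λ q)) : C(I, 𝕜))
        = q * ((H f : C(I, 𝕜)) - K f - L f • Muntz.monomial 𝕜 (Λ 0)) := by
      rw [sub_sub, mul_sub]
      rfl
    calc _ = ‖q * ((H f : C(I, 𝕜)) - K f - L f • Muntz.monomial 𝕜 (Λ 0))‖ := by rw [← h1]; rfl
      _ ≤ _ := hKL f
      _ ≤ _ := by
        gcongr
        exact Muntz.norm_mul_monomial_le q _
  · refine Muntz.distCompact_le _ (by positivity) fun η hη => ?_
    -- With target C the exponent l need not belong to Λ. The error is η/2 from the choice of l plus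
    -- η/2 from the approximation.
    obtain ⟨l, hl⟩ := Muntz.exists_norm_mul_monomial_le q hη
    obtain ⟨K, L, hK, hKL⟩ := Muntz.exists_compact_approx Λ hΛ hMuntz H hH q l (half_pos hη)
    refine ⟨(Muntz.weightedSpace Λ q).subtypeL ∘L Muntz.mulWeight Λ q ∘L K +
      L.smulRight (q * Muntz.monomial 𝕜 l),
      ((hK.clm_comp (Muntz.mulWeight Λ q)).clm_comp (Muntz.weightedSpace Λ q).subtypeL).add
        (Muntz.isCompactOperator_smulRight L _), fun f => ?_⟩
    have h1 : ((Muntz.weightedSpace Λ q).subtypeL ∘L Muntz.mulWeight Λ q ∘L H) f -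
        ((Muntz.weightedSpace Λ q).subtypeL ∘L Muntz.mulWeight Λ q ∘L K +
          L.smulRight (q * Muntz.monomial 𝕜 l)) f
        = q * ((H f : C(I, 𝕜)) - K f - L f • Muntz.monomial 𝕜 l) := by
      rw [sub_sub, mul_sub, mul_add, mul_smul_comm]
      rfl
    rw [h1]
    exact (hKL f).trans (mul_le_mul_of_nonneg_right (by linarith) (norm_nonneg f))
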